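/- Let $A$ be an abelian group. Let $\Gamma(A)$ be Whitehead's quadratic functor, i.e. the abelian group generated by symbols $\gamma(a)$, $a\in A$, subject to the relations $\gamma(-a)=\gamma(a)$ and $\gamma(a+b+c)-\gamma(a+b)-\gamma(a+c)-\gamma(b+c)+\gamma(a)+\gamma(b)+\gamma(c)=0$, and let $\Psi:\Gamma(A)\to A\otimes_{\mathbb Z}A$ be the homomorphism with $\Psi(\gamma(a))=a\otimes a$. Let ${}_{2^\infty}A=\{a\in A : 2^k a=0 \text{ for some } k\ge 0\}$. For an abelian group $B$ let $\sigma_1:\mathrm{Tor}_1^{\mathbb Z}(B,B)\to\mathrm{Tor}_1^{\mathbb Z}(B,B)$ be the involution induced by interchanging the two arguments, that is, by the symmetry $x\otimes y\mapsto(-1)^{|x||y|}\,y\otimes x$ of $F_\bullet\otimes F_\bullet$ for a free resolution $F_\bullet\to B$; and let $\Sigma_2^{\varepsilon}$ denote the symmetric group on two letters acting on $\mathrm{Tor}_1^{\mathbb Z}(B,B)$ so that the transposition acts as $\sigma^\varepsilon=-\sigma_1$. Then there is an exact sequence of abelian groups $$0\to H_1\bigl(\Sigma_2^{\varepsilon},\mathrm{Tor}_1^{\mathbb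 Z}({}_{2^\infty}A,{}_{2^\infty}A)\bigr)\to\Gamma(A)\xrightarrow{\ \Psi\ }A\otimes_{\mathbb Z}A\to H_2(A,\mathbb Z)\to 0,$$ where $H_2(A,\mathbb Z)$ is the second integral homology of the group $A$. -/

import Mathlib

open scoped TensorProduct

universe u v

noncomputable section

/-! ### Whitehead's quadratic functor -/

/-- A function between abelian groups is quadratic if it is even and its polarization
`(a, b) ↦ ψ (a + b) - ψ a - ψ b` is bilinear. -/
structure IsQuadraticFun {A : Type u} {B : Type v} [AddCommGroup A] [AddCommGroup B]
    (ψ : A → B) : Prop where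
  map_neg : ∀ a, ψ (-a) = ψ a
  polar_add_left : ∀ a a' b,
    ψ (a + a' + b) - ψ (a + a') - ψ b =
      (ψ (a + b) - ψ a - ψ b) + (ψ (a' + b) - ψ a' - ψ b)
  polar_add_right : ∀ a b b',
    ψ (a + (b + b')) - ψ a - ψ (b + b') =
      (ψ (a + b) - ψ a - ψ b) + (ψ (a + b') - ψ a - ψ b')

/-- The relations `γ (-a) = γ a` and
`γ (a + b + c) - γ (a + b) - γ (a + c) - γ (b + c) + γ a + γ b + γ c = 0`
between the generators of `Γ(A)`. -/
def whiteheadRelations (A : Type u) [AddCommGroup A] : AddSubgroup (FreeAbelianGroup A) :=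
  AddSubgroup.closure
    ({x | ∃ a : A, x = FreeAbelianGroup.of a - FreeAbelianGroup.of (-a)} ∪
      {x | ∃ a b c : A, x =
        FreeAbelianGroup.of (a + b + c) - FreeAbelianGroup.of (a + b) -
          FreeAbelianGroup.of (a + c) - FreeAbelianGroup.of (b + c) +
          FreeAbelianGroup.of a + FreeAbelianGroup.of b + FreeAbelianGroup.of c})

/-- Whitehead's group `Γ(A)`. -/
abbrev WhiteheadGamma (A : Type u) [AddCommGroup A] : Type u :=
  FreeAbelianGroup A ⧸ whiteheadRelations A

namespace WhiteheadGamma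

variable {A : Type u} [AddCommGroup A] {B : Type v} [AddCommGroup B]

/-- The universal quadratic function `γ : A → Γ(A)`. -/
def gamma (a : A) : WhiteheadGamma A :=
  QuotientAddGroup.mk (FreeAbelianGroup.of a)

/-- The homomorphism `Γ(A) → B` induced by a quadratic function `A → B`. -/
def lift (ψ : A → B) (h : IsQuadraticFun ψ) : WhiteheadGamma A →+ B :=
  QuotientAddGroup.lift (whiteheadRelations A) (FreeAbelianGroup.lift ψ) (by
    refine (AddSubgroup.closure_le (FreeAbelianGroup.lift ψ).ker).2 ?_
    rintro x (⟨a, rfl⟩ | ⟨a, b, c, rfl⟩)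
    · simp [AddMonoidHom.mem_ker, h.map_neg]
    · have h1 := h.polar_add_left a b c
      rw [← sub_eq_zero] at h1
      simp only [SetLike.mem_coe, AddMonoidHom.mem_ker, map_add, map_sub,
        FreeAbelianGroup.lift_apply_of]
      rw [← h1]
      abel)

@[simp]
theorem lift_gamma (ψ : A → B) (h : IsQuadraticFun ψ) (a : A) :
    lift ψ h (gamma a) = ψ a := by
  exact FreeAbelianGroup.lift_apply_of ψ a

theorem isQuadraticFun_gamma : IsQuadraticFun (gamma : A → WhiteheadGamma A) := by
  have key : ∀ a b c : A, (gamma (a + b + c) - gamma (a + b) - gamma (a + c) - gamma (b + c) +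
      gamma a + gamma b + gamma c : WhiteheadGamma A) = 0 := fun a b c =>
    (QuotientAddGroup.eq_zero_iff _).2
      (AddSubgroup.subset_closure (Or.inr ⟨a, b, c, rfl⟩))
  refine ⟨fun a => ?_, fun a a' b => ?_, fun a b b' => ?_⟩
  · have h : (gamma a - gamma (-a) : WhiteheadGamma A) = 0 :=
      (QuotientAddGroup.eq_zero_iff _).2 (AddSubgroup.subset_closure (Or.inl ⟨a, rfl⟩))
    exact (sub_eq_zero.1 h).symm
  · rw [← sub_eq_zero, ← key a a' b]
    abel
  · rw [← sub_eq_zero, ← key a b b', add_assoc a b b']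
    abel

theorem hom_ext {f g : WhiteheadGamma A →+ B} (h : ∀ a, f (gamma a) = g (gamma a)) : f = g :=
  QuotientAddGroup.addMonoidHom_ext _ (FreeAbelianGroup.lift.symm.injective (funext h))

theorem isQuadraticFun_tmul_self (A : Type u) [AddCommGroup A] :
    IsQuadraticFun (fun a : A => a ⊗ₜ[ℤ] a) where
  map_neg a := by simp [TensorProduct.neg_tmul, TensorProduct.tmul_neg]
  polar_add_left a a' b := by
    simp only [TensorProduct.add_tmul, TensorProduct.tmul_add]; abel
  polar_add_right a b b' := by
    simp only [TensorProduct.add_tmul, TensorProduct.tmul_add]; abel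

/-- The natural homomorphism `Ψ : Γ(A) → A ⊗ A`, `γ a ↦ a ⊗ a`. -/
def Psi (A : Type u) [AddCommGroup A] : WhiteheadGamma A →+ A ⊗[ℤ] A :=
  lift (fun a : A => a ⊗ₜ[ℤ] a) (isQuadraticFun_tmul_self A)

end WhiteheadGamma

/-! ### The first homology of a tensor product of two-term complexes -/

namespace TensorTwoTerm

variable {R : Type v} [CommRing R] {P₁ P₀ Q₁ Q₀ : Type u}
  [AddCommGroup P₁] [AddCommGroup P₀] [AddCommGroup Q₁] [AddCommGroup Q₀]
  [Module R P₁] [Module R P₀] [Module R Q₁] [Module R Q₀]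

/-- The differential in degree `1` of the tensor product of the complexes `f : P₁ → P₀` and
`g : Q₁ → Q₀`: `x ⊗ y ↦ f x ⊗ y` on `P₁ ⊗ Q₀` and `x ⊗ y ↦ x ⊗ g y` on `P₀ ⊗ Q₁`. -/
def d₁ (f : P₁ →ₗ[R] P₀) (g : Q₁ →ₗ[R] Q₀) :
    (P₁ ⊗[R] Q₀) × (P₀ ⊗[R] Q₁) →ₗ[R] P₀ ⊗[R] Q₀ :=
  LinearMap.coprod (f.rTensor Q₀) (g.lTensor P₀)

/-- The differential in degree `2` of the tensor product of the complexes `f : P₁ → P₀` and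
`g : Q₁ → Q₀`: `x ⊗ y ↦ f x ⊗ y - x ⊗ g y`. -/
def d₂ (f : P₁ →ₗ[R] P₀) (g : Q₁ →ₗ[R] Q₀) :
    P₁ ⊗[R] Q₁ →ₗ[R] (P₁ ⊗[R] Q₀) × (P₀ ⊗[R] Q₁) :=
  LinearMap.prod (-g.lTensor P₁) (f.rTensor Q₁)

theorem d₁_d₂ (f : P₁ →ₗ[R] P₀) (g : Q₁ →ₗ[R] Q₀) (x : P₁ ⊗[R] Q₁) :
    d₁ f g (d₂ f g x) = 0 := by
  induction x with
  | zero => simp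
  | tmul x y => simp [d₁, d₂]
  | add x y hx hy => simp [hx, hy]

/-- The `1`-cycles of the tensor product of two two-term complexes. -/
abbrev Z₁ (f : P₁ →ₗ[R] P₀) (g : Q₁ →ₗ[R] Q₀) :
    Submodule R ((P₁ ⊗[R] Q₀) × (P₀ ⊗[R] Q₁)) :=
  LinearMap.ker (d₁ f g)

/-- The `1`-boundaries, as a submodule of the `1`-cycles. -/
abbrev B₁ (f : P₁ →ₗ[R] P₀) (g : Q₁ →ₗ[R] Q₀) : Submodule R (Z₁ f g) :=
  LinearMap.range ((d₂ f g).codRestrict (Z₁ f g) (d₁_d₂ f g))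

/-- The first homology of the tensor product of two two-term complexes. -/
abbrev H₁ (f : P₁ →ₗ[R] P₀) (g : Q₁ →ₗ[R] Q₀) : Type u := Z₁ f g ⧸ B₁ f g

variable (R P₁ P₀ Q₁ Q₀) in
/-- The degree `1` part of the symmetry `x ⊗ y ↦ (-1) ^ (|x| * |y|) y ⊗ x` of tensor products of
complexes. -/
def swapC₁ : (P₁ ⊗[R] Q₀) × (P₀ ⊗[R] Q₁) →ₗ[R] (Q₁ ⊗[R] P₀) × (Q₀ ⊗[R] P₁) :=
  LinearMap.prod
    ((TensorProduct.comm R P₀ Q₁).toLinearMap ∘ₗ LinearMap.snd R _ _)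
    ((TensorProduct.comm R P₁ Q₀).toLinearMap ∘ₗ LinearMap.fst R _ _)

theorem d₁_swapC₁ (f : P₁ →ₗ[R] P₀) (g : Q₁ →ₗ[R] Q₀) (x : (P₁ ⊗[R] Q₀) × (P₀ ⊗[R] Q₁)) :
    d₁ g f (swapC₁ R P₁ P₀ Q₁ Q₀ x) = TensorProduct.comm R P₀ Q₀ (d₁ f g x) := by
  obtain ⟨x, y⟩ := x
  have h1 : f.lTensor Q₀ (TensorProduct.comm R P₁ Q₀ x) =
      TensorProduct.comm R P₀ Q₀ (f.rTensor Q₀ x) := by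
    induction x with
    | zero => simp
    | tmul x y => simp
    | add x y hx hy => simp only [map_add, hx, hy]
  have h2 : g.rTensor P₀ (TensorProduct.comm R P₀ Q₁ y) =
      TensorProduct.comm R P₀ Q₀ (g.lTensor P₀ y) := by
    induction y with
    | zero => simp
    | tmul x y => simp
    | add x y hx hy => simp only [map_add, hx, hy]
  simp [d₁, swapC₁, h1, h2, add_comm]

/-- In degree `2` the symmetry is `x ⊗ y ↦ -(y ⊗ x)`. -/
theorem swapC₁_d₂ (f : P₁ →ₗ[R] P₀) (g : Q₁ →ₗ[R] Q₀) (x : P₁ ⊗[R] Q₁) :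
    swapC₁ R P₁ P₀ Q₁ Q₀ (d₂ f g x) = d₂ g f (-TensorProduct.comm R P₁ Q₁ x) := by
  induction x with
  | zero => simp
  | tmul x y => simp [swapC₁, d₂]
  | add x y hx hy => simp only [map_add, neg_add, hx, hy]

/-- The map on first homology induced by interchanging the two complexes. -/
def swap (f : P₁ →ₗ[R] P₀) (g : Q₁ →ₗ[R] Q₀) : H₁ f g →ₗ[R] H₁ g f :=
  Submodule.mapQ (B₁ f g) (B₁ g f)
    ((swapC₁ R P₁ P₀ Q₁ Q₀).restrict (fun x hx => by
      rw [LinearMap.mem_ker] at hx ⊢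
      rw [d₁_swapC₁, hx, map_zero]))
    (by
      rintro _ ⟨x, rfl⟩
      exact ⟨-TensorProduct.comm R P₁ Q₁ x, Subtype.ext (swapC₁_d₂ f g x).symm⟩)

theorem swap_swap (f : P₁ →ₗ[R] P₀) (g : Q₁ →ₗ[R] Q₀) (x : H₁ f g) :
    swap g f (swap f g x) = x := by
  obtain ⟨x, rfl⟩ := Submodule.Quotient.mk_surjective _ x
  refine congrArg (Submodule.Quotient.mk (p := B₁ f g)) (Subtype.ext ?_)
  change swapC₁ R Q₁ Q₀ P₁ P₀ (swapC₁ R P₁ P₀ Q₁ Q₀ x.1) = x.1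
  simp [swapC₁]

end TensorTwoTerm

/-! ### `Tor₁` over the integers and its interchange involution -/

namespace IntTor

/-- The augmentation of the standard free resolution `0 → F₁ → F₀ → A → 0` of an abelian group,
where `F₀` is the free abelian group on the underlying set of `A`. -/
def aug (A : Type u) [AddCommGroup A] : (A →₀ ℤ) →ₗ[ℤ] A :=
  Finsupp.linearCombination ℤ (id : A → A)

/-- The differential `F₁ → F₀` of the standard free resolution `0 → F₁ → F₀ → A → 0`: the inclusion
of the kernel of the augmentation. The group `F₁` is free, being a subgroup of a free abelian
group. -/
abbrev bd (A : Type u) [AddCommGroup A] : LinearMap.ker (aug A) →ₗ[ℤ] (A →₀ ℤ) :=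
  (LinearMap.ker (aug A)).subtype

/-- `Tor₁(A, B)` over `ℤ`: the first homology group of the tensor product of the standard free
resolutions of `A` and `B`. -/
def Tor₁ (A B : Type u) [AddCommGroup A] [AddCommGroup B] : Type u :=
  TensorTwoTerm.H₁ (bd A) (bd B)

instance (A B : Type u) [AddCommGroup A] [AddCommGroup B] : AddCommGroup (Tor₁ A B) :=
  inferInstanceAs (AddCommGroup (TensorTwoTerm.H₁ (bd A) (bd B)))

/-- The homomorphism `σ₁ : Tor₁(A, B) → Tor₁(B, A)` induced by interchanging `A` and `B`. -/
def swap (A B : Type u) [AddCommGroup A] [AddCommGroup B] : Tor₁ A B →+ Tor₁ B A :=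
  (TensorTwoTerm.swap (bd A) (bd B)).toAddMonoidHom

theorem swap_swap (A B : Type u) [AddCommGroup A] [AddCommGroup B] (x : Tor₁ A B) :
    swap B A (swap A B x) = x :=
  TensorTwoTerm.swap_swap (bd A) (bd B) x

end IntTor

/-! ### The twisted action of the symmetric group and group homology

The coefficient ring and the group of Mathlib's group homology live in one universe,
so the integers and the symmetric group are lifted to the universe of the abelian group. -/

/-- The symmetric group on two letters. -/
abbrev SymmTwo : Type u := ULift.{u} (Equiv.Perm (Fin 2))

/-- The action of the symmetric group `Σ₂` on `Tor₁(A, A)` in which the transposition acts as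
`-σ₁`, where `σ₁` is induced by interchanging the two arguments. -/
def twistedTorRepresentation (A : Type u) [AddCommGroup A] :
    Representation (ULift.{u} ℤ) SymmTwo.{u} (IntTor.Tor₁ A A) where
  toFun g :=
    { toFun := fun x => if g = 1 then x else -IntTor.swap A A x
      map_add' := by
        intro x y
        split_ifs
        · rfl
        · rw [map_add, neg_add]
      map_smul' := by
        rintro ⟨n⟩ x
        simp only [RingHom.id_apply, ULift.smul_def]
        split_ifs
        · rfl
        · rw [map_zsmul, smul_neg] }
  map_one' := by
    ext x
    simp
  map_mul' := by
    have key : ∀ g h : SymmTwo.{u}, g ≠ 1 → h ≠ 1 → g * h = 1 := by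
      rintro ⟨g⟩ ⟨h⟩ hg hh
      have hg' : g ≠ 1 := fun e => hg (congrArg ULift.up e)
      have hh' : h ≠ 1 := fun e => hh (congrArg ULift.up e)
      have hgh : g * h = 1 := by
        revert g h
        decide
      exact congrArg ULift.up hgh
    intro g h
    apply LinearMap.ext
    intro x
    change (if g * h = 1 then x else -IntTor.swap A A x) =
      (if g = 1 then (if h = 1 then x else -IntTor.swap A A x)
        else -IntTor.swap A A (if h = 1 then x else -IntTor.swap A A x))
    by_cases hg : g = 1
    · simp [hg]
    · by_cases hh : h = 1
      · simp [hh]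
      · simp [hg, hh, key g h hg hh, IntTor.swap_swap]

/-- `H₁(Σ₂^ε, Tor₁(A, A))`. -/
abbrev twistedH₁ (A : Type u) [AddCommGroup A] : ModuleCat.{u} (ULift.{u} ℤ) :=
  groupHomology (Rep.of (twistedTorRepresentation A)) 1

/-- The integral homology `Hₙ(G, ℤ)` of a group `G`, with trivial action on `ℤ`. -/
abbrev integralGroupHomology (G : Type u) [Group G] (n : ℕ) : ModuleCat.{u} (ULift.{u} ℤ) :=
  groupHomology (Rep.trivial (ULift.{u} ℤ) G (ULift.{u} ℤ)) n

end

/-! The cokernel and the kernel of `Psi` are treated separately.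

Cokernel. The map `A ⊗ A → H₂(A)` is the shuffle product `a ⊗ b ↦ [a|b] - [b|a]`. Evaluating the
bilinear cocycle `[a|b] ↦ a ⊗ b` on the image of `t` gives `t - comm t`, so tensors in the kernel
are symmetric, and symmetric tensors lie in the image of `Psi` (`exists_Psi_eq_of_comm_eq`). The map
is onto because `[a|b]`, modulo boundaries and shuffles, is a symmetric cocycle. The extension it
defines is abelian, hence receives a homomorphism from the free abelian group of 1-chains, and this
forces every 2-cycle to vanish in the quotient.

Kernel. Take `0 → R → F → A → 0` with `F` free. Then `Psi` identifies `Γ(F)` with the symmetric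
tensors of `F ⊗ F`, and the kernel of `Psi A` is represented by symmetric tensors coming from some
`u` in `R ⊗ F`. Such a `u` amounts to a 1-cycle `(u, -comm u)` of the complex computing `Tor₁(A,
A)`, namely one negated by the interchange. Matching the relations of `Γ(A)`, which come from `Γ(R)`
and `R ⊗ F`, with boundaries and elements `y - σ₁ y` (`exists_hom`, `exists_antiCycle`) identifies
the kernel with `{σ₁ x = -x} / {y - σ₁ y}`. This is the odd homology of a group of order two whose
generator acts as `-σ₁`.

Finally `polar ∘ Psi = 2`, so the kernel is killed by 2 and odd multiples are harmless; it therefore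
sees only the 2-primary component (`primaryComponent_comparison`). -/

noncomputable section

/-! ### Polarization and functoriality of `Γ`. -/

namespace WhiteheadGamma

variable {A B C : Type u} [AddCommGroup A] [AddCommGroup B] [AddCommGroup C]

theorem induction_on {p : WhiteheadGamma A → Prop} (x : WhiteheadGamma A)
    (gamma : ∀ a, p (gamma a)) (add : ∀ x y, p x → p y → p (x + y))
    (neg : ∀ x, p x → p (-x)) : p x := by
  obtain ⟨x, rfl⟩ := QuotientAddGroup.mk_surjective x
  induction x using FreeAbelianGroup.induction_on with
  | zero =>
    have h := add _ _ (gamma 0) (neg _ (gamma 0))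
    rwa [add_neg_cancel] at h
  | of a => exact gamma a
  | neg a _ => exact neg _ (gamma a)
  | add x y hx hy => exact add _ _ hx hy

@[simp]
theorem Psi_gamma (a : A) : Psi A (gamma a) = a ⊗ₜ[ℤ] a :=
  lift_gamma _ _ a

theorem gamma_neg (a : A) : gamma (-a) = gamma a :=
  isQuadraticFun_gamma.map_neg a

/-- The homomorphism `A ⊗ A → Γ(A)`, `a ⊗ b ↦ γ (a + b) - γ a - γ b`. -/
def polar (A : Type u) [AddCommGroup A] : A ⊗[ℤ] A →+ WhiteheadGamma A :=
  (TensorProduct.lift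
    (AddMonoidHom.toIntLinearMap
      { toFun := fun a => AddMonoidHom.toIntLinearMap
          (AddMonoidHom.mk' (fun b => gamma (a + b) - gamma a - gamma b)
            (isQuadraticFun_gamma.polar_add_right a))
        map_zero' := by
          ext b
          have h := isQuadraticFun_gamma.polar_add_left (0 : A) 0 b
          simpa using h
        map_add' := fun a a' => by
          ext b
          exact isQuadraticFun_gamma.polar_add_left a a' b } :
      A →ₗ[ℤ] A →ₗ[ℤ] WhiteheadGamma A)).toAddMonoidHom

@[simp]
theorem polar_tmul (a b : A) : polar A (a ⊗ₜ b) = gamma (a + b) - gamma a - gamma b :=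
  rfl

theorem gamma_add (a b : A) : gamma (a + b) = gamma a + gamma b + polar A (a ⊗ₜ b) := by
  rw [polar_tmul]; abel

theorem gamma_zero : gamma (0 : A) = 0 := by
  have h := gamma_add (0 : A) 0
  rw [TensorProduct.zero_tmul, map_zero] at h
  simpa using h

theorem polar_comm (t : A ⊗[ℤ] A) : polar A (TensorProduct.comm ℤ A A t) = polar A t := by
  induction t with
  | zero => simp
  | tmul a b => simp only [TensorProduct.comm_tmul, polar_tmul, add_comm b a]; abel
  | add x y hx hy => simp only [map_add, hx, hy]

theorem Psi_polar (t : A ⊗[ℤ] A) : Psi A (polar A t) = t + TensorProduct.comm ℤ A A t := by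
  induction t with
  | zero => simp
  | tmul a b =>
    simp only [polar_tmul, map_sub, Psi_gamma, TensorProduct.add_tmul, TensorProduct.tmul_add,
      TensorProduct.comm_tmul]
    abel
  | add x y hx hy => simp only [map_add, hx, hy]; abel

theorem polar_tmul_self (a : A) : polar A (a ⊗ₜ a) = (2 : ℤ) • gamma a := by
  have h : polar A (a ⊗ₜ (-a)) = -polar A (a ⊗ₜ a) := by rw [TensorProduct.tmul_neg, map_neg]
  have h' : polar A (a ⊗ₜ (-a)) = -((2 : ℤ) • gamma a) := by
    rw [polar_tmul, add_neg_cancel, gamma_zero, gamma_neg, two_smul]; abel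
  exact neg_injective (h.symm.trans h')

/-- This is what makes the kernel of `Psi` a group of exponent 2. -/
theorem polar_Psi (g : WhiteheadGamma A) : polar A (Psi A g) = (2 : ℤ) • g := by
  induction g using induction_on with
  | gamma a => rw [Psi_gamma, polar_tmul_self]
  | add x y hx hy => simp only [map_add, hx, hy, smul_add]
  | neg x hx => simp only [map_neg, hx, smul_neg]

theorem two_smul_eq_zero_of_Psi_eq_zero {g : WhiteheadGamma A} (h : Psi A g = 0) :
    (2 : ℤ) • g = 0 := by
  rw [← polar_Psi, h, map_zero]

theorem odd_smul_of_Psi_eq_zero {g : WhiteheadGamma A} (h : Psi A g = 0) {m : ℤ} (hm : Odd m) :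
    m • g = g := by
  obtain ⟨k, rfl⟩ := hm
  rw [add_smul, one_smul, mul_comm, mul_smul, two_smul_eq_zero_of_Psi_eq_zero h, smul_zero,
    zero_add]

theorem comm_Psi (g : WhiteheadGamma A) : TensorProduct.comm ℤ A A (Psi A g) = Psi A g := by
  induction g using induction_on with
  | gamma a => simp
  | add x y hx hy => simp only [map_add, hx, hy]
  | neg x hx => simp only [map_neg, hx]

/-- Functoriality of Whitehead's group. -/
def map (f : A →ₗ[ℤ] B) : WhiteheadGamma A →+ WhiteheadGamma B :=
  lift (fun a => gamma (f a))
    { map_neg := fun a => by rw [map_neg, gamma_neg]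
      polar_add_left := fun a a' b => by
        simp only [map_add]; exact isQuadraticFun_gamma.polar_add_left _ _ _
      polar_add_right := fun a b b' => by
        simp only [map_add]; exact isQuadraticFun_gamma.polar_add_right _ _ _ }

@[simp]
theorem map_gamma (f : A →ₗ[ℤ] B) (a : A) : map f (gamma a) = gamma (f a) :=
  lift_gamma _ _ a

theorem map_map (f : A →ₗ[ℤ] B) (g : B →ₗ[ℤ] C) (x : WhiteheadGamma A) :
    map g (map f x) = map (g ∘ₗ f) x := by
  induction x using induction_on with
  | gamma a => simp
  | add x y hx hy => simp only [map_add, hx, hy]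
  | neg x hx => simp only [map_neg, hx]

theorem map_zero_hom (x : WhiteheadGamma A) : map (0 : A →ₗ[ℤ] B) x = 0 := by
  induction x using induction_on with
  | gamma a => simp [gamma_zero]
  | add x y hx hy => simp only [map_add, hx, hy, add_zero]
  | neg x hx => simp only [map_neg, hx, neg_zero]

theorem map_polar (f : A →ₗ[ℤ] B) (t : A ⊗[ℤ] A) :
    map f (polar A t) = polar B (TensorProduct.map f f t) := by
  induction t with
  | zero => simp
  | tmul a b => simp
  | add x y hx hy => simp only [map_add, hx, hy]

theorem Psi_map (f : A →ₗ[ℤ] B) (g : WhiteheadGamma A) :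
    Psi B (map f g) = TensorProduct.map f f (Psi A g) := by
  induction g using induction_on with
  | gamma a => simp
  | add x y hx hy => simp only [map_add, hx, hy]
  | neg x hx => simp only [map_neg, hx]

theorem map_surjective {f : A →ₗ[ℤ] B} (hf : Function.Surjective f) :
    Function.Surjective (map f) := by
  intro x
  induction x using induction_on with
  | gamma b =>
    obtain ⟨a, rfl⟩ := hf b
    exact ⟨gamma a, map_gamma f a⟩
  | add x y hx hy =>
    obtain ⟨x, rfl⟩ := hx
    obtain ⟨y, rfl⟩ := hy
    exact ⟨x + y, map_add _ x y⟩
  | neg x hx =>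
    obtain ⟨x, rfl⟩ := hx
    exact ⟨-x, map_neg _ x⟩

/-- The kernel of `Γ(F) → Γ(A)` for a surjection `F → A` with kernel `R` is generated by the images
of `Γ(R)` and `R ⊗ F`. -/
theorem exists_of_map_eq_zero {i : A →ₗ[ℤ] B} {p : B →ₗ[ℤ] C} (hip : Function.Exact i p)
    (hp : Function.Surjective p) {g : WhiteheadGamma B} (hg : map p g = 0) :
    ∃ (r : WhiteheadGamma A) (t : A ⊗[ℤ] B), g = map i r + polar B (i.rTensor B t) := by
  let K : AddSubgroup (WhiteheadGamma B) :=
    (map i).range ⊔ ((polar B).comp (i.rTensor B).toAddMonoidHom).range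
  suffices hK : g ∈ K by
    obtain ⟨_, ⟨r, rfl⟩, _, ⟨t, rfl⟩, h⟩ := AddSubgroup.mem_sup.1 hK
    exact ⟨r, t, h.symm⟩
  -- Modulo `K`, `γ x` depends only on `p x`. Hence `γ` descends to a quadratic function on `C`, and
  -- the map it induces from `Γ(C)` shows that the kernel of `map p` lies in `K`.
  have hq : ∀ x y, p x = p y →
      (gamma x : WhiteheadGamma B ⧸ K) = (gamma y : WhiteheadGamma B) := by
    intro x y hxy
    obtain ⟨a, ha⟩ := (hip (x - y)).1 (by rw [map_sub, hxy, sub_self])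
    have hx : x = i a + y := by rw [ha]; abel
    rw [eq_comm, QuotientAddGroup.eq, hx, gamma_add]
    have e : -gamma y + (gamma (i a) + gamma y + polar B (i a ⊗ₜ[ℤ] y)) =
        map i (gamma a) + polar B (i.rTensor B (a ⊗ₜ y)) := by
      rw [map_gamma, LinearMap.rTensor_tmul]; abel
    rw [e]
    exact add_mem (AddSubgroup.mem_sup_left ⟨_, rfl⟩) (AddSubgroup.mem_sup_right ⟨a ⊗ₜ y, rfl⟩)
  let s := Function.surjInv hp
  have hs : ∀ c, p (s c) = c := Function.surjInv_eq hp
  let ψ : C → WhiteheadGamma B ⧸ K := fun c => ((gamma (s c) : WhiteheadGamma B) : _ ⧸ K)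
  have hψ : ∀ x, ψ (p x) = ((gamma x : WhiteheadGamma B) : _ ⧸ K) := fun x => hq _ _ (hs _)
  have hquad : IsQuadraticFun ψ := by
    refine ⟨fun a => ?_, fun a a' b => ?_, fun a b b' => ?_⟩
    · obtain ⟨a, rfl⟩ := hp a
      rw [← map_neg, hψ, hψ, gamma_neg]
    · obtain ⟨a, rfl⟩ := hp a
      obtain ⟨a', rfl⟩ := hp a'
      obtain ⟨b, rfl⟩ := hp b
      simp only [← map_add, hψ]
      exact congrArg (QuotientAddGroup.mk' K) (isQuadraticFun_gamma.polar_add_left a a' b)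
    · obtain ⟨a, rfl⟩ := hp a
      obtain ⟨b, rfl⟩ := hp b
      obtain ⟨b', rfl⟩ := hp b'
      simp only [← map_add, hψ]
      exact congrArg (QuotientAddGroup.mk' K) (isQuadraticFun_gamma.polar_add_right a b b')
  have key : (lift ψ hquad).comp (map p) = QuotientAddGroup.mk' K :=
    hom_ext fun x => by
      rw [AddMonoidHom.comp_apply, map_gamma, lift_gamma, hψ]; rfl
  have h := DFunLike.congr_fun key g
  rw [AddMonoidHom.comp_apply, hg, _root_.map_zero] at h
  exact (QuotientAddGroup.eq_zero_iff g).1 h.symm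

/-! ### Symmetric tensors -/

/-- The `e k` play the role of projections to cyclic summands. Diagonal blocks of `t` are multiples
of `a k ⊗ a k`, and symmetry pairs the off-diagonal blocks as `x + comm x`, which is `Psi` of a
polarization. -/
theorem exists_Psi_eq_of_sum_eq_id {κ : Type*} [Fintype κ]
    (e : κ → A →ₗ[ℤ] A) (a : κ → A) (ha : ∀ k x, ∃ n : ℤ, e k x = n • a k)
    (he : ∑ k, e k = LinearMap.id) {t : A ⊗[ℤ] A} (ht : TensorProduct.comm ℤ A A t = t) :
    ∃ g, Psi A g = t := by
  have hdiag : ∀ k (t : A ⊗[ℤ] A), TensorProduct.map (e k) (e k) t ∈ (Psi A).range := by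
    intro k t
    induction t with
    | zero => rw [_root_.map_zero]; exact zero_mem _
    | tmul x y =>
      obtain ⟨m, hm⟩ := ha k x
      obtain ⟨n, hn⟩ := ha k y
      refine ⟨(m * n) • gamma (a k), ?_⟩
      rw [map_zsmul, Psi_gamma, TensorProduct.map_tmul, hm, hn, TensorProduct.smul_tmul_smul]
    | add x y hx hy => rw [map_add]; exact add_mem hx hy
  have hswap : ∀ k l, TensorProduct.map (e l) (e k) t =
      TensorProduct.comm ℤ A A (TensorProduct.map (e k) (e l) t) := by
    intro k l
    rw [← TensorProduct.map_comm, ht]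
  have hsum : t = ∑ k, ∑ l, TensorProduct.map (e k) (e l) t := by
    have h : (TensorProduct.mapBilinear (RingHom.id ℤ) A A A A) (∑ k, e k) (∑ l, e l) t = t := by
      rw [he, TensorProduct.mapBilinear_apply, TensorProduct.map_id, LinearMap.id_apply]
    simp only [map_sum, LinearMap.sum_apply, TensorProduct.mapBilinear_apply] at h
    rw [Finset.sum_comm]
    exact h.symm
  classical
  have hmem : ∀ s : Finset κ,
      ∑ k ∈ s, ∑ l ∈ s, TensorProduct.map (e k) (e l) t ∈ (Psi A).range := by
    intro s
    induction s using Finset.induction_on with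
    | empty => rw [Finset.sum_empty]; exact zero_mem _
    | insert k s hk ih =>
      have hoff : ∑ l ∈ s, (TensorProduct.map (e k) (e l) t + TensorProduct.map (e l) (e k) t) ∈
          (Psi A).range :=
        sum_mem fun l _ => ⟨polar A (TensorProduct.map (e k) (e l) t), by
          rw [Psi_polar, hswap k l]⟩
      have h := add_mem (add_mem (hdiag k t) hoff) ih
      convert h using 1
      simp only [Finset.sum_insert hk, Finset.sum_add_distrib]
      abel
  have h := hmem Finset.univ
  rw [← hsum] at h
  exact h

theorem exists_cyclic_decomposition (A : Type u) [AddCommGroup A] [Module.Finite ℤ A] :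
    ∃ (κ : Type) (_ : Fintype κ) (e : κ → A →ₗ[ℤ] A) (a : κ → A),
      (∀ k x, ∃ n : ℤ, e k x = n • a k) ∧ ∑ k, e k = LinearMap.id := by
  classical
  have : AddGroup.FG A := Module.Finite.iff_addGroup_fg.1 inferInstance
  obtain ⟨n, ι, _, p, -, m, ⟨f⟩⟩ := AddCommGroup.equiv_free_prod_directSum_zmod A
  let M : ι → Type := fun i => ZMod (p i ^ m i)
  let f' : A ≃ₗ[ℤ] (Fin n →₀ ℤ) × DirectSum ι M := f.toIntLinearEquiv
  refine ⟨Fin n ⊕ ι, inferInstance,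
    Sum.elim
      (fun i => f'.symm.toLinearMap ∘ₗ LinearMap.inl ℤ _ _ ∘ₗ Finsupp.lsingle i ∘ₗ
        Finsupp.lapply i ∘ₗ LinearMap.fst ℤ _ _ ∘ₗ f'.toLinearMap)
      (fun i => f'.symm.toLinearMap ∘ₗ LinearMap.inr ℤ _ _ ∘ₗ DirectSum.lof ℤ ι M i ∘ₗ
        DirectSum.component ℤ ι M i ∘ₗ LinearMap.snd ℤ _ _ ∘ₗ f'.toLinearMap),
    Sum.elim (fun i => f'.symm (Finsupp.single i 1, 0))
      (fun i => f'.symm (0, DirectSum.lof ℤ ι M i (1 : ZMod (p i ^ m i)))), ?_, ?_⟩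
  · rintro (i | i) x
    · refine ⟨(f' x).1 i, ?_⟩
      simp only [Sum.elim_inl, LinearMap.comp_apply, LinearEquiv.coe_coe, ← map_zsmul]
      simp
    · obtain ⟨c, hc⟩ := ZMod.intCast_surjective (n := p i ^ m i) ((f' x).2 i)
      refine ⟨c, ?_⟩
      simp only [Sum.elim_inr, LinearMap.comp_apply, LinearEquiv.coe_coe, ← map_zsmul]
      simp [DirectSum.component, ← map_zsmul]
      exact congrArg _ hc.symm
  · ext x
    apply f'.injective
    simp only [Fintype.sum_sum_type, LinearMap.add_apply, LinearMap.sum_apply, Sum.elim_inl,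
      Sum.elim_inr, LinearMap.comp_apply, LinearEquiv.coe_coe, map_add, map_sum,
      LinearEquiv.apply_symm_apply, LinearMap.id_apply]
    refine Prod.ext ?_ ?_
    · simp [Prod.fst_sum]
    · simp only [Prod.snd_sum, LinearMap.inl_apply, LinearMap.inr_apply, Finset.sum_const_zero,
        Prod.snd_add, zero_add, LinearMap.snd_apply]
      exact DirectSum.sum_univ_of (f' x).2

theorem exists_fg_map_subtype_eq (t : A ⊗[ℤ] A) :
    ∃ (P : Submodule ℤ A) (s : P ⊗[ℤ] P), P.FG ∧ TensorProduct.map P.subtype P.subtype s = t := by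
  obtain ⟨P₁, P₂, h₁, h₂, h⟩ :=
    TensorProduct.exists_finite_submodule_of_setFinite {t} (Set.finite_singleton t)
  obtain ⟨s, hs⟩ := h rfl
  refine ⟨P₁ ⊔ P₂, TensorProduct.map (Submodule.inclusion le_sup_left)
    (Submodule.inclusion le_sup_right) s,
    (Module.Finite.iff_fg.1 h₁).sup (Module.Finite.iff_fg.1 h₂), ?_⟩
  rw [← hs, TensorProduct.mapIncl, ← LinearMap.comp_apply, ← TensorProduct.map_comp]
  rfl

/-- The vanishing of a tensor uses finitely many elements of `A`. The two factors are enlarged one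
after the other, then both to the common submodule `Q₁ ⊔ Q₂`. -/
theorem exists_fg_map_inclusion_eq_zero {P : Submodule ℤ A} (hP : P.FG) {t : P ⊗[ℤ] P}
    (ht : TensorProduct.map P.subtype P.subtype t = 0) :
    ∃ (Q : Submodule ℤ A) (hPQ : P ≤ Q), Q.FG ∧
      TensorProduct.map (Submodule.inclusion hPQ) (Submodule.inclusion hPQ) t = 0 := by
  rw [← LinearMap.rTensor_comp_lTensor, LinearMap.comp_apply] at ht
  obtain ⟨Q₁, h₁, hQ₁, ht⟩ := TensorProduct.eq_zero_of_fg_of_subtype_eq_zero hP ht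
  have ht' : P.subtype.rTensor Q₁
      (TensorProduct.comm ℤ Q₁ P ((Submodule.inclusion h₁).rTensor P t)) = 0 := by
    rw [← LinearMap.comp_apply, LinearMap.rTensor_comp_lTensor, ← LinearMap.lTensor_comp_rTensor,
      LinearMap.comp_apply] at ht
    rw [LinearMap.rTensor_comm, ht, map_zero]
  obtain ⟨Q₂, h₂, hQ₂, ht'⟩ := TensorProduct.eq_zero_of_fg_of_subtype_eq_zero hP ht'
  rw [LinearMap.rTensor_comm, LinearEquiv.map_eq_zero_iff, ← LinearMap.comp_apply,
    LinearMap.lTensor_comp_rTensor] at ht'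
  refine ⟨Q₁ ⊔ Q₂, h₁.trans le_sup_left, hQ₁.sup hQ₂, ?_⟩
  have h := congrArg (TensorProduct.map (Submodule.inclusion (le_sup_left : Q₁ ≤ Q₁ ⊔ Q₂))
    (Submodule.inclusion (le_sup_right : Q₂ ≤ Q₁ ⊔ Q₂))) ht'
  rw [← LinearMap.comp_apply, ← TensorProduct.map_comp, map_zero] at h
  exact h

/-- A lift of `t` to a finitely generated `P` need not be symmetric, but becomes so in a larger
finitely generated `Q`, where the decomposition into cyclic groups applies. -/
theorem exists_Psi_eq_of_comm_eq {t : A ⊗[ℤ] A} (ht : TensorProduct.comm ℤ A A t = t) :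
    ∃ g, Psi A g = t := by
  obtain ⟨P, s', hP, hs'⟩ := exists_fg_map_subtype_eq t
  have h0 : TensorProduct.map P.subtype P.subtype (TensorProduct.comm ℤ P P s' - s') = 0 := by
    rw [map_sub, TensorProduct.map_comm, hs', ht, sub_self]
  obtain ⟨Q, hPQ, hQ, h⟩ := exists_fg_map_inclusion_eq_zero hP h0
  rw [map_sub, TensorProduct.map_comm, sub_eq_zero] at h
  have : Module.Finite ℤ Q := Module.Finite.iff_fg.2 hQ
  obtain ⟨κ, _, e, a, ha, he⟩ := exists_cyclic_decomposition Q
  obtain ⟨g, hg⟩ := exists_Psi_eq_of_sum_eq_id e a ha he h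
  refine ⟨map Q.subtype g, ?_⟩
  rw [Psi_map, hg, ← hs', ← LinearMap.comp_apply, ← TensorProduct.map_comp]
  rfl

/-! ### Free abelian groups -/

section Free

variable {ι : Type*} (b : Module.Basis ι ℤ A)

/-- The homomorphism from `A ⊗ A` with prescribed values on the tensors of basis elements. -/
def ofBasis (c : ι → ι → B) : A ⊗[ℤ] A →+ B :=
  (TensorProduct.lift (b.constr ℤ fun i => b.constr ℤ fun j => c i j)).toAddMonoidHom

@[simp]
theorem ofBasis_apply (c : ι → ι → B) (i j : ι) : ofBasis b c (b i ⊗ₜ b j) = c i j := by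
  simp [ofBasis]

theorem tensor_ext_basis {f g : A ⊗[ℤ] A →+ B} (h : ∀ i j, f (b i ⊗ₜ b j) = g (b i ⊗ₜ b j)) :
    f = g := by
  have hmk : ∀ f : A ⊗[ℤ] A →+ B, ∃ f' : A →ₗ[ℤ] A →ₗ[ℤ] B, ∀ x y, f' x y = f (x ⊗ₜ y) :=
    fun f => ⟨AddMonoidHom.toIntLinearMap
      { toFun := fun x => (f.comp (TensorProduct.mk ℤ A A x).toAddMonoidHom).toIntLinearMap
        map_zero' := by ext; simp
        map_add' := fun x y => by ext; simp }, fun x y => rfl⟩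
  obtain ⟨f', hf⟩ := hmk f
  obtain ⟨g', hg⟩ := hmk g
  have hfg : f' = g' := b.ext fun i => b.ext fun j => by rw [hf, hg, h]
  ext t
  induction t with
  | zero => simp
  | tmul x y => rw [← hf, ← hg, hfg]
  | add x y hx hy => rw [map_add, map_add, hx, hy]

variable [LinearOrder ι]

/-- A retraction of `Ψ` for a free abelian group with an ordered basis. -/
def retraction : A ⊗[ℤ] A →+ WhiteheadGamma A :=
  ofBasis b fun i j =>
    if i < j then polar A (b i ⊗ₜ b j) else if i = j then gamma (b i) else 0

theorem retraction_tmul_add_tmul (x y : A) :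
    retraction b (x ⊗ₜ y) + retraction b (y ⊗ₜ x) = polar A (x ⊗ₜ y) := by
  have h : retraction b + (retraction b).comp
      (TensorProduct.comm ℤ A A).toLinearMap.toAddMonoidHom = polar A := by
    refine tensor_ext_basis b fun i j => ?_
    simp only [AddMonoidHom.add_apply, AddMonoidHom.comp_apply, LinearMap.toAddMonoidHom_coe,
      LinearEquiv.coe_coe, TensorProduct.comm_tmul, retraction, ofBasis_apply]
    rcases lt_trichotomy i j with h | rfl | h
    · simp [h, h.not_gt, h.ne']
    · rw [if_neg (lt_irrefl i), if_pos rfl, polar_tmul_self, two_smul]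
    · rw [if_neg h.not_gt, if_neg h.ne', if_pos h, zero_add, ← polar_comm,
        TensorProduct.comm_tmul]
  exact DFunLike.congr_fun h (x ⊗ₜ y)

theorem retraction_Psi (g : WhiteheadGamma A) : retraction b (Psi A g) = g := by
  -- The property is stable under sums because `retraction` sends `x ⊗ y + y ⊗ x` to the
  -- polarization; so checking basis elements suffices.
  let S : AddSubgroup A :=
    { carrier := {a | retraction b (a ⊗ₜ a) = gamma a}
      zero_mem' := by simp [gamma_zero]
      neg_mem' := fun {x} hx => by
        simpa [TensorProduct.neg_tmul, TensorProduct.tmul_neg, gamma_neg] using hx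
      add_mem' := fun {x y} hx hy => by
        simp only [Set.mem_ofPred_eq] at hx hy ⊢
        rw [gamma_add, ← retraction_tmul_add_tmul b, ← hx, ← hy]
        simp only [TensorProduct.add_tmul, TensorProduct.tmul_add, map_add]
        abel }
  have hS : ∀ a, a ∈ S := fun a => by
    rw [← b.linearCombination_repr a, Finsupp.linearCombination_apply]
    refine sum_mem fun i _ => S.zsmul_mem (?_ : retraction b (b i ⊗ₜ b i) = gamma (b i)) _
    rw [retraction, ofBasis_apply, if_neg (lt_irrefl i), if_pos rfl]
  induction g using induction_on with
  | gamma a => rw [Psi_gamma]; exact hS a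
  | add x y hx hy => simp only [map_add, hx, hy]
  | neg x hx => simp only [map_neg, hx]

end Free

theorem Psi_injective_of_free (A : Type u) [AddCommGroup A] [Module.Free ℤ A] :
    Function.Injective (Psi A) := by
  classical
  let b := Module.Free.chooseBasis ℤ A
  let : LinearOrder (Module.Free.ChooseBasisIndex ℤ A) := linearOrderOfSTO WellOrderingRel
  exact Function.LeftInverse.injective (retraction_Psi b)

/-- Antisymmetric tensors over a free abelian group are alternating. -/
theorem exists_sub_comm_eq_of_free [Module.Free ℤ A] {t : A ⊗[ℤ] A}
    (ht : TensorProduct.comm ℤ A A t = -t) : ∃ r, t = r - TensorProduct.comm ℤ A A r := by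
  classical
  let b := Module.Free.chooseBasis ℤ A
  let : LinearOrder (Module.Free.ChooseBasisIndex ℤ A) := linearOrderOfSTO WellOrderingRel
  let c : A ⊗[ℤ] A →+ A ⊗[ℤ] A := (TensorProduct.comm ℤ A A).toLinearMap.toAddMonoidHom
  let L := ofBasis b fun i j => if i < j then b i ⊗ₜ[ℤ] b j else 0
  -- `L'` is chosen so that `key` holds on basis tensors; on antisymmetric `t` its right side is `L'
  -- t - L' t = 0`. Dividing by 2 in coordinates then shows that `t` is its strictly upper part
  -- minus the flip of it.
  let L' := ofBasis b fun i j =>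
    if i < j then 0 else if i = j then b i ⊗ₜ[ℤ] b j else (2 : ℕ) • b i ⊗ₜ[ℤ] b j
  have key : (2 : ℕ) • (AddMonoidHom.id _ - L + c.comp L) = L' + L'.comp c := by
    refine tensor_ext_basis b fun i j => ?_
    simp only [AddMonoidHom.add_apply, AddMonoidHom.sub_apply, AddMonoidHom.smul_apply,
      AddMonoidHom.id_apply, AddMonoidHom.comp_apply, c, LinearMap.toAddMonoidHom_coe,
      LinearEquiv.coe_coe, TensorProduct.comm_tmul, L, L', ofBasis_apply]
    rcases lt_trichotomy i j with h | rfl | h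
    · simp [h, h.not_gt, h.ne']
    · simp [two_smul]
    · simp [h, h.not_gt, h.ne']
  refine ⟨L t, ?_⟩
  have h := DFunLike.congr_fun key t
  have hc : c t = -t := ht
  have h2 : (2 : ℕ) • (t - L t + c (L t)) = 0 := by
    simpa [hc] using h
  have h3 : t - L t + c (L t) = 0 := by
    refine (b.tensorProduct b).repr.map_eq_zero_iff.1 (Finsupp.ext fun x => ?_)
    have h4 := DFunLike.congr_fun (congrArg (b.tensorProduct b).repr h2) x
    rw [map_nsmul, map_zero] at h4
    simp only [nsmul_eq_mul, Finsupp.smul_apply, Finsupp.zero_apply] at h4 ⊢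
    exact (mul_eq_zero.1 h4).resolve_left (by norm_num)
  rw [← sub_eq_zero, ← h3]
  change _ = t - L t + TensorProduct.comm ℤ A A (L t)
  abel

/-! ### Torsion-free abelian groups -/

theorem map_self_injective [Module.Flat ℤ A] [Module.Flat ℤ B] {i : A →ₗ[ℤ] B}
    (hi : Function.Injective i) : Function.Injective (TensorProduct.map i i) := by
  rw [← LinearMap.rTensor_comp_lTensor, LinearMap.coe_comp]
  exact (Module.Flat.rTensor_preserves_injective_linearMap i hi).comp
    (Module.Flat.lTensor_preserves_injective_linearMap i hi)

theorem free_of_fg_of_flat [Module.Flat ℤ A] {P : Submodule ℤ A} (hP : P.FG) :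
    Module.Free ℤ P := by
  have : Module.Finite ℤ P := Module.Finite.iff_fg.2 hP
  infer_instance

theorem exists_fg_map_eq (g : WhiteheadGamma A) :
    ∃ (P : Submodule ℤ A) (h : WhiteheadGamma P), P.FG ∧ map P.subtype h = g := by
  induction g using induction_on with
  | gamma a =>
    exact ⟨ℤ ∙ a, gamma ⟨a, Submodule.mem_span_singleton_self a⟩,
      Submodule.fg_span_singleton a, map_gamma _ _⟩
  | add x y hx hy =>
    obtain ⟨P, x, hP, rfl⟩ := hx
    obtain ⟨Q, y, hQ, rfl⟩ := hy
    refine ⟨P ⊔ Q, map (Submodule.inclusion le_sup_left) x +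
      map (Submodule.inclusion le_sup_right) y, hP.sup hQ, ?_⟩
    rw [map_add, map_map, map_map]
    rfl
  | neg x hx =>
    obtain ⟨P, x, hP, rfl⟩ := hx
    exact ⟨P, -x, hP, map_neg _ _⟩

/-- Finitely generated subgroups of a flat group are free, and flatness makes `P ⊗ P → A ⊗ A`
injective. -/
theorem Psi_injective (A : Type u) [AddCommGroup A] [Module.Flat ℤ A] :
    Function.Injective (Psi A) := by
  rw [injective_iff_map_eq_zero]
  intro g hg
  obtain ⟨P, h, hP, rfl⟩ := exists_fg_map_eq g
  have := free_of_fg_of_flat hP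
  rw [Psi_map] at hg
  have h0 : Psi P h = 0 := map_self_injective P.injective_subtype (hg.trans (map_zero _).symm)
  rw [Psi_injective_of_free P (h0.trans (map_zero _).symm), map_zero]

/-- Antisymmetric tensors over a torsion-free abelian group are alternating. -/
theorem exists_sub_comm_eq_of_comm_eq_neg [Module.Flat ℤ A] {t : A ⊗[ℤ] A}
    (ht : TensorProduct.comm ℤ A A t = -t) : ∃ r, t = r - TensorProduct.comm ℤ A A r := by
  obtain ⟨P, s, hP, rfl⟩ := exists_fg_map_subtype_eq t
  have := free_of_fg_of_flat hP
  obtain ⟨r, rfl⟩ := exists_sub_comm_eq_of_free (t := s) <|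
    map_self_injective P.injective_subtype (by rw [TensorProduct.map_comm, ht, map_neg])
  exact ⟨TensorProduct.map P.subtype P.subtype r, by rw [map_sub, TensorProduct.map_comm]⟩

end WhiteheadGamma

/-! ### Symmetric cocycles -/

/-- A symmetric `2`-cocycle on an abelian group with values in an abelian group. -/
structure SymmCocycle (A : Type u) (M : Type v) [AddCommGroup A] [AddCommGroup M] where
  /-- The underlying function. -/
  f : A → A → M
  symm : ∀ a b, f a b = f b a
  cocycle : ∀ a b c, f b c + f a (b + c) = f (a + b) c + f a b

namespace SymmCocycle

variable {A : Type u} {M : Type v} [AddCommGroup A] [AddCommGroup M] (s : SymmCocycle A M)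

theorem apply_zero (a : A) : s.f a 0 = s.f 0 0 := by
  have h := s.cocycle a 0 0
  rw [add_zero, add_zero] at h
  exact (add_right_cancel h).symm

/-- The abelian extension defined by a symmetric `2`-cocycle. -/
@[ext]
structure Extension (s : SymmCocycle A M) where
  /-- The component in the quotient. -/
  fst : A
  /-- The component in the kernel. -/
  snd : M

namespace Extension

instance : Add s.Extension := ⟨fun x y => ⟨x.fst + y.fst, x.snd + y.snd + s.f x.fst y.fst⟩⟩
-- The cocycle is not normalized, so `f 0 0` corrects the zero, the negatives and the inclusion of
-- the kernel.
instance : Zero s.Extension := ⟨⟨0, -s.f 0 0⟩⟩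
instance : Neg s.Extension :=
  ⟨fun x => ⟨-x.fst, -x.snd - s.f (-x.fst) x.fst - s.f 0 0⟩⟩

theorem add_def (x y : s.Extension) :
    x + y = ⟨x.fst + y.fst, x.snd + y.snd + s.f x.fst y.fst⟩ := rfl

theorem zero_def : (0 : s.Extension) = ⟨0, -s.f 0 0⟩ := rfl

theorem neg_def (x : s.Extension) :
    -x = ⟨-x.fst, -x.snd - s.f (-x.fst) x.fst - s.f 0 0⟩ := rfl

instance : AddCommGroup s.Extension :=
  have hcomm : ∀ x y : s.Extension, x + y = y + x := fun x y => by
    ext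
    · exact add_comm _ _
    · simp only [add_def, s.symm x.fst y.fst, add_comm x.snd y.snd]
  have hzero : ∀ x : s.Extension, x + 0 = x := fun x => by
    ext
    · exact add_zero _
    · simp only [add_def, zero_def, s.apply_zero, neg_add_cancel_right]
  { add_assoc := fun x y z => by
      ext
      · exact add_assoc _ _ _
      · simp only [add_def]
        have h := s.cocycle x.fst y.fst z.fst
        rw [eq_comm, ← sub_eq_zero] at h ⊢
        rw [← neg_eq_zero, ← h]
        abel
    zero_add := fun x => by rw [hcomm, hzero]
    add_zero := hzero
    add_comm := hcomm
    nsmul := nsmulRec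
    zsmul := zsmulRec
    neg_add_cancel := fun x => by
      ext
      · exact neg_add_cancel _
      · simp only [add_def, zero_def, neg_def]; abel }

/-- The inclusion of the kernel in the extension. -/
def incl : M →+ s.Extension :=
  AddMonoidHom.mk' (fun m => ⟨0, m - s.f 0 0⟩) fun m n => by
    ext
    · exact (add_zero _).symm
    · simp only [add_def]; abel

theorem incl_injective : Function.Injective (incl s) := fun _ _ h =>
  sub_left_injective (congrArg Extension.snd h)

/-- The section `a ↦ (a, 0)` has coboundary `f`. The left side has the shape of the bar differential
of `[a|b]`. -/
theorem section_add (a b : A) :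
    (⟨b, 0⟩ - ⟨a + b, 0⟩ + ⟨a, 0⟩ : s.Extension) = incl s (s.f a b) := by
  have h : (⟨a, 0⟩ + ⟨b, 0⟩ : s.Extension) = ⟨a + b, 0⟩ + incl s (s.f a b) := by
    ext
    · exact (add_zero _).symm
    · simp only [add_def, incl, AddMonoidHom.mk'_apply, s.apply_zero]; abel
  rw [← sub_eq_iff_eq_add'] at h
  rw [← h]
  abel

end Extension

end SymmCocycle

/-! ### The second homology of an abelian group -/

namespace AbelianHomology

open groupHomology

variable (A : Type u) [AddCommGroup A]

/-- The trivial representation of an abelian group on the integers. -/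
abbrev triv : Rep (ULift.{u} ℤ) (Multiplicative A) :=
  Rep.trivial (ULift.{u} ℤ) (Multiplicative A) (ULift.{u} ℤ)

variable {A}

/-- The inhomogeneous chain `n [a | b]`. -/
def chain (n : ULift.{u} ℤ) (a b : A) : Multiplicative A × Multiplicative A →₀ ULift.{u} ℤ :=
  Finsupp.single (Multiplicative.ofAdd a, Multiplicative.ofAdd b) n

theorem d₃₂_apply_single (n : ULift.{u} ℤ) (a b c : A) :
    d₃₂ (triv A) (Finsupp.single
      (Multiplicative.ofAdd a, Multiplicative.ofAdd b, Multiplicative.ofAdd c) n) =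
    chain n b c - chain n (a + b) c + chain n a (b + c) - chain n a b := by
  rw [d₃₂_single]
  rfl

theorem d₂₁_chain (n : ULift.{u} ℤ) (a b : A) :
    d₂₁ (triv A) (chain n a b) =
    (Finsupp.single (Multiplicative.ofAdd b) n - Finsupp.single (Multiplicative.ofAdd (a + b)) n +
      Finsupp.single (Multiplicative.ofAdd a) n :
      Multiplicative A →₀ ULift.{u} ℤ) := by
  rw [chain, d₂₁_single]
  rfl

theorem mem_boundaries₂ (n : ULift.{u} ℤ) (a b c : A) :
    chain n b c - chain n (a + b) c + chain n a (b + c) - chain n a b ∈ boundaries₂ (triv A) :=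
  ⟨_, d₃₂_apply_single n a b c⟩

/-- The cycle `[a | b] - [b | a]`. -/
def shuffle (a b : A) : cycles₂ (triv A) :=
  ⟨chain 1 a b - chain 1 b a, by
    change d₂₁ (triv A) (chain 1 a b - chain 1 b a) = 0
    erw [map_sub]
    rw [d₂₁_chain, d₂₁_chain, add_comm b a]
    abel⟩

theorem shuffle_add_left (a a' b : A) :
    H2π (triv A) (shuffle (a + a') b) =
      H2π (triv A) (shuffle a b) + H2π (triv A) (shuffle a' b) := by
  rw [← map_add, H2π_eq_iff]
  -- The difference is minus the boundary of the signed shuffles `[a|a'|b] - [a|b|a'] + [b|a|a']`.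
  have h := neg_mem (sub_mem (add_mem (mem_boundaries₂ 1 a a' b) (mem_boundaries₂ 1 b a a'))
    (mem_boundaries₂ 1 a b a'))
  convert h using 1
  simp only [shuffle, Submodule.coe_add, add_comm a' b, add_comm b a]
  abel

theorem shuffle_comm (a b : A) :
    H2π (triv A) (shuffle a b) = -H2π (triv A) (shuffle b a) := by
  rw [← map_neg]
  refine congrArg _ (Subtype.ext ?_)
  simp [shuffle]

/-- The homomorphism `A ⊗ A → H₂(A)` given by the shuffle product. -/
def shuffleHom (A : Type u) [AddCommGroup A] :
    A ⊗[ℤ] A →+ integralGroupHomology (Multiplicative A) 2 :=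
  (TensorProduct.lift
    (AddMonoidHom.toIntLinearMap (AddMonoidHom.mk'
      (fun a => AddMonoidHom.toIntLinearMap (AddMonoidHom.mk'
        (fun b => (H2π (triv A) (shuffle a b) : integralGroupHomology (Multiplicative A) 2))
        (fun b b' => by
          rw [shuffle_comm, shuffle_add_left, shuffle_comm a b, shuffle_comm a b', neg_add])))
      (fun a a' => by ext b; exact shuffle_add_left a a' b)))).toAddMonoidHom

theorem shuffleHom_tmul (a b : A) : shuffleHom A (a ⊗ₜ b) = H2π (triv A) (shuffle a b) := rfl

/-- The homomorphism from chains to `A ⊗ A`, `[a | b] ↦ a ⊗ b`. -/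
def chainToTensor (A : Type u) [AddCommGroup A] :
    (Multiplicative A × Multiplicative A →₀ ULift.{u} ℤ) →+ A ⊗[ℤ] A :=
  Finsupp.liftAddHom fun g =>
    AddMonoidHom.mk' (fun n => n.down • (g.1.toAdd ⊗ₜ[ℤ] g.2.toAdd)) fun m n => by
      rw [ULift.add_down, add_smul]

theorem chainToTensor_chain (n : ULift.{u} ℤ) (a b : A) :
    chainToTensor A (chain n a b) = n.down • (a ⊗ₜ[ℤ] b) := by
  simp [chainToTensor, chain]

/-- A bilinear map is a 2-cocycle. -/
theorem chainToTensor_eq_zero {x : Multiplicative A × Multiplicative A →₀ ULift.{u} ℤ}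
    (hx : x ∈ boundaries₂ (triv A)) : chainToTensor A x = 0 := by
  obtain ⟨y, rfl⟩ := hx
  induction y using Finsupp.induction_linear with
  | zero => simp
  | add y z hy hz =>
    rw [map_add]
    erw [map_add]
    rw [hy, hz, add_zero]
  | single g n =>
    obtain ⟨a, b, c⟩ := g
    have h := d₃₂_apply_single n a.toAdd b.toAdd c.toAdd
    refine (congrArg (chainToTensor A) h).trans ?_
    simp only [map_sub, map_add, chainToTensor_chain, TensorProduct.add_tmul,
      TensorProduct.tmul_add, smul_add]
    abel

theorem exists_cycle (t : A ⊗[ℤ] A) : ∃ z : cycles₂ (triv A),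
    H2π (triv A) z = shuffleHom A t ∧
      chainToTensor A z.1 = t - TensorProduct.comm ℤ A A t := by
  induction t with
  | zero => exact ⟨0, by simp, by simp⟩
  | tmul a b =>
    refine ⟨shuffle a b, rfl, ?_⟩
    simp [shuffle, chainToTensor_chain]
  | add x y hx hy =>
    obtain ⟨z, hz, hz'⟩ := hx
    obtain ⟨w, hw, hw'⟩ := hy
    refine ⟨z + w, by rw [map_add, map_add, hz, hw], ?_⟩
    rw [Submodule.coe_add]
    refine (map_add (chainToTensor A) _ _).trans ?_
    rw [hz', hw', map_add]
    abel

theorem exact_Psi_shuffleHom (A : Type u) [AddCommGroup A] :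
    Function.Exact (WhiteheadGamma.Psi A) (shuffleHom A) := by
  intro t
  constructor
  · intro h
    obtain ⟨z, hz, hz'⟩ := exists_cycle t
    rw [h, H2π_eq_zero_iff] at hz
    rw [chainToTensor_eq_zero hz, eq_comm, sub_eq_zero] at hz'
    exact WhiteheadGamma.exists_Psi_eq_of_comm_eq hz'.symm
  · rintro ⟨g, rfl⟩
    induction g using WhiteheadGamma.induction_on with
    | gamma a =>
      rw [WhiteheadGamma.Psi_gamma, shuffleHom_tmul, H2π_eq_zero_iff]
      simp [shuffle]
    | add x y hx hy => rw [map_add, map_add, hx, hy, add_zero]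
    | neg x hx => rw [map_neg, map_neg, hx, neg_zero]

theorem shuffleHom_surjective (A : Type u) [AddCommGroup A] :
    Function.Surjective (shuffleHom A) := by
  -- `S` is the group of 2-cycles whose class is in the image of the shuffle map; the aim is that it
  -- contains all cycles.
  let S : AddSubgroup (Multiplicative A × Multiplicative A →₀ ULift.{u} ℤ) :=
    ((shuffleHom A).range.comap (H2π (triv A)).hom.toAddMonoidHom).map
      (cycles₂ (triv A)).subtype.toAddMonoidHom
  have hb : ∀ x ∈ boundaries₂ (triv A), x ∈ S := fun x hx => by
    refine ⟨⟨x, boundaries₂_le_cycles₂ _ hx⟩, ⟨0, ?_⟩, rfl⟩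
    rw [map_zero]
    exact ((H2π_eq_zero_iff (A := triv A) ⟨x, boundaries₂_le_cycles₂ _ hx⟩).2 hx).symm
  have hs : ∀ a b : A, chain 1 a b - chain 1 b a ∈ S := fun a b =>
    ⟨shuffle a b, ⟨a ⊗ₜ b, rfl⟩, rfl⟩
  obtain ⟨M, _, q, hq⟩ : ∃ (M : Type u) (_ : AddCommGroup M)
      (q : (Multiplicative A × Multiplicative A →₀ ULift.{u} ℤ) →+ M), ∀ x, q x = 0 ↔ x ∈ S :=
    ⟨_ ⧸ S, QuotientAddGroup.Quotient.addCommGroup S, QuotientAddGroup.mk' S,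
      fun x => by exact QuotientAddGroup.eq_zero_iff x⟩
  let s : SymmCocycle A M :=
    { f := fun a b => q (chain 1 a b)
      symm := fun a b => by
        rw [← sub_eq_zero, ← map_sub, hq]
        exact hs a b
      cocycle := fun a b c => by
        rw [← sub_eq_zero, ← map_add, ← map_add, ← map_sub, hq]
        convert hb _ (mem_boundaries₂ 1 a b c) using 1
        abel }
  -- The section extends additively to 1-chains since the extension is abelian. By `hψ`, `ψ ∘ d₂₁`
  -- is `q` followed by an injection, so `q` kills cycles.
  let ψ : (Multiplicative A →₀ ULift.{u} ℤ) →+ s.Extension :=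
    Finsupp.liftAddHom fun g =>
      AddMonoidHom.mk' (fun n => n.down • (⟨g.toAdd, 0⟩ : s.Extension)) fun m n => by
        rw [ULift.add_down, add_smul]
  have hψ_single : ∀ (a : A) n, ψ (Finsupp.single (Multiplicative.ofAdd a) n) =
      n.down • (⟨a, 0⟩ : s.Extension) := fun a n => by
    simp [ψ]
  have hψ : ∀ x, ψ (d₂₁ (triv A) x) = SymmCocycle.Extension.incl s (q x) := by
    intro x
    induction x using Finsupp.induction_linear with
    | zero => erw [map_zero, map_zero, map_zero]
    | add y z hy hz => erw [map_add, map_add, map_add, map_add, hy, hz]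
    | single g n =>
      obtain ⟨a, b⟩ := g
      have h := d₂₁_chain n a.toAdd b.toAdd
      refine (congrArg ψ h).trans ?_
      have hn : (Finsupp.single (a, b) n : Multiplicative A × Multiplicative A →₀ ULift.{u} ℤ) =
          n.down • chain 1 a.toAdd b.toAdd := by
        rw [chain, Finsupp.smul_single]
        congr 1
        ext
        simp
      rw [map_add, map_sub, hψ_single, hψ_single, hψ_single, ← smul_sub, ← smul_add,
        SymmCocycle.Extension.section_add, hn, map_zsmul, map_zsmul]
  intro x
  induction x using H2_induction_on with | h z =>
  have hz := hψ z.1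
  have hz' : d₂₁ (triv A) z.1 = 0 := LinearMap.mem_ker.1 z.2
  rw [hz', map_zero, eq_comm, map_eq_zero_iff _ (SymmCocycle.Extension.incl_injective s), hq] at hz
  obtain ⟨w, ⟨t, ht⟩, hw⟩ := hz
  have hw : w = z := Subtype.ext hw
  exact ⟨t, by rw [ht, hw]; rfl⟩

end AbelianHomology

/-! ### The kernel of `Ψ` in terms of a free presentation -/

namespace FreePresentation

open WhiteheadGamma

variable {R F A : Type u} [AddCommGroup R] [AddCommGroup F] [AddCommGroup A]
  {i : R →ₗ[ℤ] F} {p : F →ₗ[ℤ] A}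

theorem map_map_rTensor (hip : Function.Exact i p) (w : R ⊗[ℤ] F) :
    TensorProduct.map p p (i.rTensor F w) = 0 := by
  rw [← LinearMap.comp_apply, LinearMap.map_comp_rTensor, hip.linearMap_comp_eq_zero,
    TensorProduct.map_zero_left, LinearMap.zero_apply]

theorem map_polar_rTensor (hip : Function.Exact i p) (w : R ⊗[ℤ] F) :
    map p (polar F (i.rTensor F w)) = 0 := by
  rw [map_polar, map_map_rTensor hip, map_zero]

theorem rTensor_lTensor (i : R →ₗ[ℤ] F) (r : R ⊗[ℤ] R) :
    i.rTensor F (i.lTensor R r) = TensorProduct.map i i r := by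
  rw [← LinearMap.comp_apply, LinearMap.rTensor_comp_lTensor]

/-- A symmetric tensor over `F` represents zero in `Γ(A)` if and only if it is the sum of a tensor
over `R` and of the symmetrization of an element of `R ⊗ F`. -/
theorem map_eq_zero_iff [Module.Flat ℤ R] [Module.Flat ℤ F]
    (hip : Function.Exact i p) (hp : Function.Surjective p) (g : WhiteheadGamma F) :
    map p g = 0 ↔ ∃ (r : R ⊗[ℤ] R) (w : R ⊗[ℤ] F), TensorProduct.comm ℤ R R r = r ∧
      Psi F g = TensorProduct.map i i r + i.rTensor F w +
        TensorProduct.comm ℤ F F (i.rTensor F w) := by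
  constructor
  · intro h
    obtain ⟨r, w, rfl⟩ := exists_of_map_eq_zero hip hp h
    exact ⟨Psi R r, w, comm_Psi r, by rw [map_add, Psi_map, Psi_polar, add_assoc]⟩
  · rintro ⟨r, w, hr, h⟩
    obtain ⟨r, rfl⟩ := exists_Psi_eq_of_comm_eq hr
    have hg : g = map i r + polar F (i.rTensor F w) :=
      Psi_injective F (by rw [h, map_add, Psi_map, Psi_polar, add_assoc])
    rw [hg, map_add, map_polar_rTensor hip, map_map, hip.linearMap_comp_eq_zero, map_zero_hom,
      add_zero]

/-- Every element of the kernel of `Ψ` is represented by a symmetric tensor in the image of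
`R ⊗ F`. -/
theorem exists_of_Psi_eq_zero (hip : Function.Exact i p) (hp : Function.Surjective p)
    {c : WhiteheadGamma A} (hc : Psi A c = 0) :
    ∃ (u : R ⊗[ℤ] F) (g : WhiteheadGamma F), Psi F g = i.rTensor F u ∧ map p g = c := by
  obtain ⟨g, rfl⟩ := map_surjective hp c
  rw [Psi_map, ← LinearMap.mem_ker, TensorProduct.map_ker hip hp hip hp] at hc
  obtain ⟨_, ⟨v, rfl⟩, _, ⟨u, rfl⟩, h⟩ := Submodule.mem_sup.1 hc
  -- The kernel of `F ⊗ F → A ⊗ A` is `R ⊗ F + F ⊗ R`. Subtracting the polarization of the flipped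
  -- `F ⊗ R` part does not change the class in `Γ(A)` and moves that part into `R ⊗ F`.
  have hv : TensorProduct.comm ℤ F F (i.rTensor F (TensorProduct.comm ℤ F R v)) =
      i.lTensor F v := by
    rw [LinearMap.rTensor_comm, TensorProduct.comm_comm]
  refine ⟨u - TensorProduct.comm ℤ F R v,
    g - polar F (i.rTensor F (TensorProduct.comm ℤ F R v)), ?_, ?_⟩
  · rw [map_sub, Psi_polar, hv, map_sub, ← h]
    abel
  · rw [map_sub, map_polar_rTensor hip, sub_zero]

theorem Psi_map_eq_zero (hip : Function.Exact i p) {g : WhiteheadGamma F} {u : R ⊗[ℤ] F}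
    (h : Psi F g = i.rTensor F u) : Psi A (map p g) = 0 := by
  rw [Psi_map, h, map_map_rTensor hip]

/-- The group of `1`-cycles on which interchanging the factors is multiplication by `-1`. -/
def antiCycles (i : R →ₗ[ℤ] F) : AddSubgroup (TensorTwoTerm.Z₁ i i) where
  carrier := {z | TensorTwoTerm.swapC₁ ℤ R F R F z.1 = -z.1}
  zero_mem' := by simp
  add_mem' := fun {x y} hx hy => by
    simp only [Set.mem_ofPred_eq, Submodule.coe_add, map_add] at hx hy ⊢
    rw [hx, hy, neg_add]
  neg_mem' := fun {x} hx => by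
    simp only [Set.mem_ofPred_eq, Submodule.coe_neg, map_neg] at hx ⊢
    rw [hx]

theorem snd_eq (z : antiCycles i) : z.1.1.2 = -TensorProduct.comm ℤ R F z.1.1.1 := by
  have h := congrArg Prod.snd z.2
  exact (neg_eq_iff_eq_neg.2 h).symm

theorem comm_rTensor_fst (z : antiCycles i) :
    TensorProduct.comm ℤ F F (i.rTensor F z.1.1.1) = i.rTensor F z.1.1.1 := by
  have h : i.rTensor F z.1.1.1 + i.lTensor F z.1.1.2 = 0 := LinearMap.mem_ker.1 z.1.2
  rw [snd_eq, map_neg, LinearMap.lTensor_comm, ← sub_eq_add_neg, sub_eq_zero] at h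
  exact h.symm

/-- The element of `antiCycles i` with given first component. -/
def antiCycle (u : R ⊗[ℤ] F) (hu : TensorProduct.comm ℤ F F (i.rTensor F u) = i.rTensor F u) :
    antiCycles i :=
  ⟨⟨(u, -TensorProduct.comm ℤ R F u), by
    change i.rTensor F u + i.lTensor F (-TensorProduct.comm ℤ R F u) = 0
    rw [map_neg, LinearMap.lTensor_comm, hu, add_neg_cancel]⟩, by
    change (TensorProduct.comm ℤ F R (-TensorProduct.comm ℤ R F u), TensorProduct.comm ℤ R F u) =
      (-u, -(-TensorProduct.comm ℤ R F u))
    rw [map_neg, TensorProduct.comm_comm, neg_neg]⟩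

theorem swap_mk (z : antiCycles i) :
    TensorTwoTerm.swap i i (Submodule.Quotient.mk z.1) = -Submodule.Quotient.mk z.1 :=
  congrArg (Submodule.Quotient.mk (p := TensorTwoTerm.B₁ i i)) (Subtype.ext z.2)

/-- If `z + swap z = d₂ s`, invariance of the left side and injectivity of `d₂` make `s`
antisymmetric, so `s = r - comm r`, and `z - d₂ r` is negated on the nose. -/
theorem exists_antiCycle [Module.Flat ℤ R] [Module.Flat ℤ F] (hi : Function.Injective i)
    (h : TensorTwoTerm.H₁ i i) (hh : TensorTwoTerm.swap i i h = -h) :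
    ∃ z : antiCycles i, Submodule.Quotient.mk z.1 = h := by
  obtain ⟨z, rfl⟩ := Submodule.Quotient.mk_surjective _ h
  obtain ⟨s, hs⟩ := (Submodule.Quotient.eq (TensorTwoTerm.B₁ i i)).1 hh
  have hs : TensorTwoTerm.d₂ i i s = TensorTwoTerm.swapC₁ ℤ R F R F z.1 + z.1 :=
    (congrArg Subtype.val hs).trans (sub_neg_eq_add _ _)
  have hsnd : TensorTwoTerm.swapC₁ ℤ R F R F (TensorTwoTerm.swapC₁ ℤ R F R F z.1) = z.1 := by
    simp [TensorTwoTerm.swapC₁]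
  have hs' : TensorTwoTerm.d₂ i i (TensorProduct.comm ℤ R R s) = TensorTwoTerm.d₂ i i (-s) := by
    have h := TensorTwoTerm.swapC₁_d₂ i i s
    rw [hs, map_add, hsnd, map_neg, eq_comm, neg_eq_iff_eq_neg] at h
    rw [h, map_neg, hs, add_comm]
  have hs' : TensorProduct.comm ℤ R R s = -s := by
    have h : i.rTensor R (TensorProduct.comm ℤ R R s) = i.rTensor R (-s) :=
      congrArg Prod.snd hs'
    exact Module.Flat.rTensor_preserves_injective_linearMap i hi h
  obtain ⟨r, hr⟩ := exists_sub_comm_eq_of_comm_eq_neg hs'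
  refine ⟨⟨z - ⟨_, TensorTwoTerm.d₁_d₂ i i r⟩, ?_⟩, ?_⟩
  · change TensorTwoTerm.swapC₁ ℤ R F R F (z.1 - TensorTwoTerm.d₂ i i r) =
      -(z.1 - TensorTwoTerm.d₂ i i r)
    rw [hr, map_sub] at hs
    rw [map_sub, TensorTwoTerm.swapC₁_d₂, ← sub_eq_zero, ← sub_eq_zero.2 hs.symm, map_neg]
    abel
  · refine (Submodule.Quotient.eq (TensorTwoTerm.B₁ i i)).2 ⟨-r, Subtype.ext ?_⟩
    change TensorTwoTerm.d₂ i i (-r) = z.1 - TensorTwoTerm.d₂ i i r - z.1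
    rw [map_neg]
    abel

/-- `β` sends `(u, -comm u)` to the image in `Γ(A)` of the element of `Γ(F)` whose `Psi` is the
symmetric tensor of `u`. The retraction serves only to make this choice additive. -/
theorem exists_hom [Module.Flat ℤ R] [Module.Free ℤ F] (hi : Function.Injective i)
    (hip : Function.Exact i p) (hp : Function.Surjective p) :
    ∃ β : antiCycles i →+ WhiteheadGamma A,
      (∀ z, β z = 0 ↔ ∃ y, Submodule.Quotient.mk z.1 = y - TensorTwoTerm.swap i i y) ∧
      ∀ c, Psi A c = 0 ↔ ∃ z, β z = c := by
  classical
  let b := Module.Free.chooseBasis ℤ F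
  let : LinearOrder (Module.Free.ChooseBasisIndex ℤ F) := linearOrderOfSTO WellOrderingRel
  let β : antiCycles i →+ WhiteheadGamma A := AddMonoidHom.mk'
    (fun z => map p (retraction b (i.rTensor F z.1.1.1))) fun x y => by
      rw [← map_add, ← map_add, ← map_add]; rfl
  have hβ : ∀ z g, Psi F g = i.rTensor F z.1.1.1 → β z = map p g := fun z g h => by
    change map p (retraction b (i.rTensor F z.1.1.1)) = map p g
    rw [← h, retraction_Psi]
  refine ⟨β, fun z => ?_, fun c => ⟨fun hc => ?_, ?_⟩⟩
  · obtain ⟨g, hg⟩ := exists_Psi_eq_of_comm_eq (comm_rTensor_fst z)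
    rw [hβ z g hg, map_eq_zero_iff hip hp, hg]
    constructor
    · rintro ⟨r, w, hr, h⟩
      -- `w` and `w'` become flips of each other in `F ⊗ F`, so `(w, -comm w')` is a cycle `y`, and
      -- `z` differs from `y - swap y` by `d₂ (-r)`.
      let w' : R ⊗[ℤ] F := z.1.1.1 - i.lTensor R r - w
      have hw' : i.rTensor F w' = TensorProduct.comm ℤ F F (i.rTensor F w) := by
        rw [map_sub, map_sub, rTensor_lTensor, h]; abel
      let y : TensorTwoTerm.Z₁ i i := ⟨(w, -TensorProduct.comm ℤ R F w'), by
        change i.rTensor F w + i.lTensor F (-TensorProduct.comm ℤ R F w') = 0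
        rw [map_neg, LinearMap.lTensor_comm, hw', TensorProduct.comm_comm, add_neg_cancel]⟩
      refine ⟨Submodule.Quotient.mk y, ?_⟩
      refine (Submodule.Quotient.eq (TensorTwoTerm.B₁ i i)).2 ⟨-r, Subtype.ext (Prod.ext ?_ ?_)⟩
      · change -i.lTensor R (-r) = z.1.1.1 - (w - TensorProduct.comm ℤ F R
          (-TensorProduct.comm ℤ R F w'))
        rw [map_neg, map_neg, TensorProduct.comm_comm,
          show w' = z.1.1.1 - i.lTensor R r - w from rfl]
        abel
      · change i.rTensor R (-r) = z.1.1.2 - (-TensorProduct.comm ℤ R F w' -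
          TensorProduct.comm ℤ R F w)
        rw [snd_eq, map_neg, map_sub, map_sub, ← LinearMap.rTensor_comm, hr]
        abel
    · rintro ⟨y, hy⟩
      obtain ⟨y, rfl⟩ := Submodule.Quotient.mk_surjective _ y
      obtain ⟨s, hs⟩ := (Submodule.Quotient.eq (TensorTwoTerm.B₁ i i)).1 hy
      have hs : -i.lTensor R s = z.1.1.1 - (y.1.1 - TensorProduct.comm ℤ F R y.1.2) :=
        congrArg (fun x => x.1.1) hs
      have hy : i.rTensor F y.1.1 + i.lTensor F y.1.2 = 0 := LinearMap.mem_ker.1 y.2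
      have hx : i.rTensor F z.1.1.1 = TensorProduct.map i i (-s) + i.rTensor F y.1.1 +
          TensorProduct.comm ℤ F F (i.rTensor F y.1.1) := by
        rw [eq_neg_of_add_eq_zero_left hy]
        have hz : z.1.1.1 = -i.lTensor R s + (y.1.1 - TensorProduct.comm ℤ F R y.1.2) := by
          rw [hs]; abel
        rw [hz, map_add, map_sub, map_neg, rTensor_lTensor, LinearMap.rTensor_comm, map_neg,
          map_neg, eq_neg_of_add_eq_zero_left hy]
        abel
      refine ⟨-s, y.1.1, map_self_injective hi ?_, hx⟩
      -- The tensor of `z` and the symmetrization are both symmetric, hence so is the image of `-s`;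
      -- injectivity of `i ⊗ i` transfers this to `-s`.
      have h := comm_rTensor_fst z
      rw [hx, map_add, map_add, TensorProduct.comm_comm, ← TensorProduct.map_comm, add_assoc,
        add_assoc, add_comm (i.rTensor F y.1.1)] at h
      exact add_right_cancel h
  · obtain ⟨u, g, hg, rfl⟩ := exists_of_Psi_eq_zero hip hp hc
    have hu : TensorProduct.comm ℤ F F (i.rTensor F u) = i.rTensor F u := by
      rw [← hg, comm_Psi]
    exact ⟨antiCycle u hu, hβ _ g hg⟩
  · rintro ⟨z, rfl⟩
    obtain ⟨g, hg⟩ := exists_Psi_eq_of_comm_eq (comm_rTensor_fst z)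
    rw [hβ z g hg]
    exact Psi_map_eq_zero hip hg

end FreePresentation

/-! ### Reduction to the 2-primary component. -/

namespace FreePresentation

open WhiteheadGamma

section Comparison

variable {R F F' A T : Type u} [AddCommGroup R] [AddCommGroup F] [AddCommGroup F']
  [AddCommGroup A] [AddCommGroup T]
  {i : R →ₗ[ℤ] F} {p : F →ₗ[ℤ] A} {i' : R →ₗ[ℤ] F'} {p' : F' →ₗ[ℤ] T}
  {j : F' →ₗ[ℤ] F} {t : T →ₗ[ℤ] A}

/-- The torsion-free quotient of an abelian group is flat. -/
theorem exists_flat_quotient (p : F →ₗ[ℤ] A) (hp : Function.Surjective p) :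
    ∃ (Q : Type u) (_ : AddCommGroup Q) (_ : Module.Flat ℤ Q) (q : F →ₗ[ℤ] Q),
      Function.Surjective q ∧ ∀ x, q x = 0 ↔ ∃ n : ℤ, n ≠ 0 ∧ n • p x = 0 := by
  refine ⟨A ⧸ Submodule.torsion ℤ A, inferInstance, inferInstance,
    (Submodule.torsion ℤ A).mkQ ∘ₗ p, (Submodule.mkQ_surjective _).comp hp, fun x => ?_⟩
  rw [LinearMap.comp_apply, Submodule.mkQ_apply, Submodule.Quotient.mk_eq_zero,
    Submodule.mem_torsion_iff]
  constructor
  · rintro ⟨n, hn⟩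
    exact ⟨n, nonZeroDivisors.coe_ne_zero n, hn⟩
  · rintro ⟨n, hn, h⟩
    exact ⟨⟨n, mem_nonZeroDivisors_of_ne_zero hn⟩, h⟩

/-- An element of `R ⊗ F` that also comes from `F ⊗ R` involves only elements of `F` that are
torsion in `A`. By hypothesis, odd multiples of these lie in `F'`. -/
theorem exists_odd_smul_eq_lTensor [Module.Flat ℤ R] [Module.Flat ℤ F]
    (hi : Function.Injective i)
    (hip : Function.Exact i p) (hp : Function.Surjective p)
    (hj : ∀ x, ∀ n : ℤ, n ≠ 0 → n • p x = 0 → ∃ m : ℤ, Odd m ∧ m • x ∈ LinearMap.range j)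
    {u : R ⊗[ℤ] F} {v : F ⊗[ℤ] R} (huv : i.rTensor F u = i.lTensor F v) :
    ∃ (m : ℤ) (u' : R ⊗[ℤ] F'), Odd m ∧ m • u = j.lTensor R u' := by
  obtain ⟨Q, _, _, q, hq, hq0⟩ := exists_flat_quotient p hp
  have hqi : q ∘ₗ i = 0 := by
    ext x
    exact (hq0 _).2 ⟨1, one_ne_zero, by rw [hip.apply_apply_eq_zero, smul_zero]⟩
  -- `R ⊗ Q → F ⊗ Q` is injective, and there `u` agrees with the image of `v`, which vanishes since
  -- `q ∘ i = 0`.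
  have hu : q.lTensor R u = 0 := by
    apply Module.Flat.rTensor_preserves_injective_linearMap (M := Q) i hi
    rw [map_zero, ← LinearMap.comp_apply, LinearMap.rTensor_comp_lTensor,
      ← LinearMap.lTensor_comp_rTensor, LinearMap.comp_apply, huv, ← LinearMap.comp_apply,
      ← LinearMap.lTensor_comp, hqi, LinearMap.lTensor_zero, LinearMap.zero_apply]
  obtain ⟨y, rfl⟩ := (lTensor_exact R (LinearMap.exact_subtype_ker_map q) hq _).1 hu
  clear hu huv
  induction y with
  | zero => exact ⟨1, 0, odd_one, by simp⟩
  | tmul r x =>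
    obtain ⟨n, hn, h⟩ := (hq0 x.1).1 x.2
    obtain ⟨m, hm, x', hx'⟩ := hj x.1 n hn h
    exact ⟨m, r ⊗ₜ x', hm, by
      rw [LinearMap.lTensor_tmul, LinearMap.lTensor_tmul, hx', TensorProduct.tmul_smul]; rfl⟩
  | add x y hx hy =>
    obtain ⟨m, u, hm, hu⟩ := hx
    obtain ⟨n, v, hn, hv⟩ := hy
    exact ⟨m * n, n • u + m • v, hm.mul hn, by
      rw [map_add, smul_add, mul_comm m n, mul_smul, hu, mul_comm n m, mul_smul, hv, map_add,
        map_zsmul, map_zsmul]⟩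

theorem map_lTensor (hij : j ∘ₗ i' = i) (u : R ⊗[ℤ] F') :
    TensorProduct.map j j (i'.rTensor F' u) = i.rTensor F (j.lTensor R u) := by
  rw [← LinearMap.comp_apply, LinearMap.map_comp_rTensor, hij, ← LinearMap.comp_apply,
    LinearMap.rTensor_comp_lTensor]

variable [Module.Flat ℤ R] [Module.Flat ℤ F] [Module.Flat ℤ F']
  (hi : Function.Injective i) (hip : Function.Exact i p) (hp : Function.Surjective p)
  (hip' : Function.Exact i' p') (hp' : Function.Surjective p')
  (hj : Function.Injective j) (hij : j ∘ₗ i' = i) (hpj : p ∘ₗ j = t ∘ₗ p')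
  (hodd : ∀ x, ∀ n : ℤ, n ≠ 0 → n • p x = 0 → ∃ m : ℤ, Odd m ∧ m • x ∈ LinearMap.range j)

-- An odd multiple of a representing tensor descends to `F'`; since `c` has exponent 2, that
-- multiple still represents `c`.
include hi hip hp hip' hj hij hpj hodd in
theorem exists_map_eq_of_Psi_eq_zero {c : WhiteheadGamma A} (hc : Psi A c = 0) :
    ∃ c', Psi T c' = 0 ∧ map t c' = c := by
  obtain ⟨u, g, hg, rfl⟩ := exists_of_Psi_eq_zero hip hp hc
  have hu : i.rTensor F u = i.lTensor F (TensorProduct.comm ℤ R F u) := by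
    rw [LinearMap.lTensor_comm, ← hg, comm_Psi]
  obtain ⟨m, u', hm, hu'⟩ := exists_odd_smul_eq_lTensor hi hip hp hodd hu
  have hx : TensorProduct.map j j (i'.rTensor F' u') = Psi F (m • g) := by
    rw [map_lTensor hij, ← hu', map_zsmul, map_zsmul, hg]
  obtain ⟨g', hg'⟩ : ∃ g', Psi F' g' = i'.rTensor F' u' := by
    refine exists_Psi_eq_of_comm_eq (map_self_injective hj ?_)
    rw [TensorProduct.map_comm, hx, comm_Psi]
  have hjg : map j g' = m • g := Psi_injective F (by rw [Psi_map, hg', hx])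
  refine ⟨map p' g', Psi_map_eq_zero hip' hg', ?_⟩
  rw [map_map, ← hpj, ← map_map, hjg, map_zsmul, odd_smul_of_Psi_eq_zero hc hm]

include hi hip hp hip' hp' hj hij hpj hodd in
theorem eq_zero_of_map_eq_zero {c : WhiteheadGamma T} (hc : Psi T c = 0)
    (h : map t c = 0) : c = 0 := by
  obtain ⟨u', g', hg', rfl⟩ := exists_of_Psi_eq_zero hip' hp' hc
  rw [map_map, ← hpj, ← map_map, map_eq_zero_iff hip hp, Psi_map, hg', map_lTensor hij] at h
  obtain ⟨r, w, hr, h⟩ := h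
  -- In `F ⊗ F`, the relation exhibits `w` as the flip of another element of `R ⊗ F`, so an odd
  -- multiple of `w` descends to `F'`, and the relation descends with it.
  have hw : i.rTensor F w = i.lTensor F
      (TensorProduct.comm ℤ R F (j.lTensor R u' - i.lTensor R r - w)) := by
    rw [LinearMap.lTensor_comm, map_sub (i.rTensor F), map_sub (i.rTensor F), h,
      rTensor_lTensor, add_sub_right_comm,
      add_sub_cancel_left, add_sub_cancel_left, TensorProduct.comm_comm]
  obtain ⟨m, w', hm, hw'⟩ := exists_odd_smul_eq_lTensor hi hip hp hodd hw
  rw [← odd_smul_of_Psi_eq_zero hc hm, ← map_zsmul, map_eq_zero_iff hip' hp']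
  refine ⟨m • r, w', by rw [map_zsmul, hr], map_self_injective hj ?_⟩
  have hr' : TensorProduct.map j j (TensorProduct.map i' i' r) = TensorProduct.map i i r := by
    rw [← LinearMap.comp_apply, ← TensorProduct.map_comp, hij]
  rw [map_zsmul, map_zsmul, hg', map_lTensor hij, h, map_add, map_add, map_zsmul, map_zsmul, hr',
    TensorProduct.map_comm, map_lTensor hij, ← hw', map_zsmul, map_zsmul, smul_add, smul_add]

end Comparison

/-- The inclusion of the `2`-primary component induces an isomorphism on the kernels of `Ψ`. -/
theorem primaryComponent_comparison (A : Type u) [AddCommGroup A] :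
    ∃ θ : WhiteheadGamma (AddCommGroup.primaryComponent A 2) →+ WhiteheadGamma A,
      (∀ c, Psi _ c = 0 → θ c = 0 → c = 0) ∧
      (∀ c, Psi _ c = 0 → Psi A (θ c) = 0) ∧
      ∀ c, Psi A c = 0 → ∃ c', Psi _ c' = 0 ∧ θ c' = c := by
  let T := AddCommGroup.primaryComponent A 2
  let t : T →ₗ[ℤ] A := T.subtype.toIntLinearMap
  let p := IntTor.aug A
  have hp : Function.Surjective p := fun a => ⟨Finsupp.single a 1, by simp [p, IntTor.aug]⟩
  let S : AddSubgroup (A →₀ ℤ) := T.comap p.toAddMonoidHom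
  let K : AddSubgroup (A →₀ ℤ) := p.toAddMonoidHom.ker
  have hK : K ≤ S := fun x (hx : p x = 0) => by
    change p x ∈ T
    rw [hx]; exact zero_mem T
  let i : K →ₗ[ℤ] (A →₀ ℤ) := K.subtype.toIntLinearMap
  let j : S →ₗ[ℤ] (A →₀ ℤ) := S.subtype.toIntLinearMap
  let i' : K →ₗ[ℤ] S := (AddSubgroup.inclusion hK).toIntLinearMap
  let p' : S →ₗ[ℤ] T := AddMonoidHom.toIntLinearMap
    (AddMonoidHom.mk' (fun x => (⟨p x.1, x.2⟩ : T)) fun x y => Subtype.ext (map_add p x.1 y.1))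
  have : Module.Flat ℤ K := inferInstance
  have : Module.Flat ℤ S := inferInstance
  have hip : Function.Exact i p := fun x =>
    ⟨fun hx => ⟨⟨x, hx⟩, rfl⟩, by rintro ⟨x, rfl⟩; exact x.2⟩
  have hip' : Function.Exact i' p' := fun x =>
    ⟨fun hx => ⟨⟨x.1, congrArg Subtype.val hx⟩, rfl⟩, by
      rintro ⟨x, rfl⟩; exact Subtype.ext x.2⟩
  have hp' : Function.Surjective p' := fun a => by
    obtain ⟨x, hx⟩ := hp a.1
    exact ⟨⟨x, (hx ▸ a.2 : p x ∈ T)⟩, Subtype.ext hx⟩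
  have hodd : ∀ x, ∀ n : ℤ, n ≠ 0 → n • p x = 0 →
      ∃ m : ℤ, Odd m ∧ m • x ∈ LinearMap.range j := by
    intro x n hn h
    -- If `2 ^ k * m` kills `p x` with `m` odd, then `m • p x` is 2-primary.
    obtain ⟨k, m, hm, hk⟩ := Nat.exists_eq_two_pow_mul_odd (Int.natAbs_ne_zero.2 hn)
    have h0 : (n.natAbs : ℤ) • p x = 0 := by
      rcases Int.natAbs_eq n with e | e
      · rw [← e, h]
      · rw [show (n.natAbs : ℤ) = -n by omega, neg_smul, h, neg_zero]
    refine ⟨m, by exact_mod_cast hm, ⟨(m : ℤ) • x, k, ?_⟩, rfl⟩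
    change 2 ^ k • p ((m : ℤ) • x) = 0
    rw [map_zsmul, ← h0, hk, natCast_zsmul, natCast_zsmul, mul_smul]
  have hi : Function.Injective i := Subtype.val_injective
  have hj : Function.Injective j := Subtype.val_injective
  have hij : j ∘ₗ i' = i := rfl
  have hpj : p ∘ₗ j = t ∘ₗ p' := rfl
  refine ⟨map t, fun c hc h =>
    eq_zero_of_map_eq_zero hi hip hp hip' hp' hj hij hpj hodd hc h, fun c hc => ?_, fun c hc =>
    exists_map_eq_of_Psi_eq_zero hi hip hp hip' hj hij hpj hodd hc⟩
  rw [Psi_map, hc, map_zero]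

/-- The kernel of `Ψ` in terms of the involution on `Tor₁`. -/
theorem exists_antiCycles_hom (T : Type u) [AddCommGroup T] :
    ∃ (N : Type u) (_ : AddCommGroup N) (α : N →+ IntTor.Tor₁ T T) (β : N →+ WhiteheadGamma T),
      (∀ h, (∃ z, α z = h) ↔ IntTor.swap T T h = -h) ∧
      (∀ z, β z = 0 ↔ ∃ y, α z = y - IntTor.swap T T y) ∧
      ∀ c, Psi T c = 0 ↔ ∃ z, β z = c := by
  have hp : Function.Surjective (IntTor.aug T) :=
    fun a => ⟨Finsupp.single a 1, by simp [IntTor.aug]⟩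
  have hi : Function.Injective (IntTor.bd T) := Subtype.val_injective
  have hip : Function.Exact (IntTor.bd T) (IntTor.aug T) :=
    LinearMap.exact_subtype_ker_map _
  obtain ⟨β, hβ, hβ'⟩ := exists_hom hi hip hp
  refine ⟨antiCycles (IntTor.bd T), inferInstance,
    ((TensorTwoTerm.B₁ (IntTor.bd T) (IntTor.bd T)).mkQ.toAddMonoidHom).comp
      (antiCycles (IntTor.bd T)).subtype, β, fun h => ⟨?_, exists_antiCycle hi h⟩, hβ, hβ'⟩
  rintro ⟨z, rfl⟩
  exact swap_mk z

end FreePresentation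

/-! ### The first homology of the twisted action -/

namespace TwistedHomology

open CategoryTheory

instance : CommGroup SymmTwo.{u} :=
  { (inferInstance : Group SymmTwo.{u}) with
    mul_comm := by
      rintro ⟨g⟩ ⟨h⟩
      refine congrArg ULift.up ?_
      revert g h
      decide }

/-- The transposition. -/
def transposition : SymmTwo.{u} := ⟨Equiv.swap 0 1⟩

theorem transposition_ne_one : transposition.{u} ≠ 1 := fun h =>
  absurd (congrArg ULift.down h) (by decide : (Equiv.swap 0 1 : Equiv.Perm (Fin 2)) ≠ 1)

theorem eq_one_or_eq_transposition (g : SymmTwo.{u}) : g = 1 ∨ g = transposition := by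
  obtain ⟨g⟩ := g
  have h : ∀ g : Equiv.Perm (Fin 2), g = 1 ∨ g = Equiv.swap 0 1 := by decide
  exact (h g).imp (congrArg ULift.up) (congrArg ULift.up)

theorem mem_zpowers_transposition (g : SymmTwo.{u}) : g ∈ Subgroup.zpowers transposition := by
  rcases eq_one_or_eq_transposition g with rfl | rfl
  · exact one_mem _
  · exact Subgroup.mem_zpowers _

variable (T : Type u) [AddCommGroup T]

theorem rho_transposition (x : IntTor.Tor₁ T T) :
    twistedTorRepresentation T transposition x = -IntTor.swap T T x :=
  (if_neg transposition_ne_one.{u} :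
    (if transposition.{u} = 1 then x else -IntTor.swap T T x) = -IntTor.swap T T x)

theorem norm_apply (x : IntTor.Tor₁ T T) :
    (twistedTorRepresentation T).norm x = x - IntTor.swap T T x := by
  have h : (Finset.univ : Finset SymmTwo.{u}) = {1, transposition} := by
    ext g
    simpa using eq_one_or_eq_transposition g
  rw [Representation.norm, LinearMap.sum_apply, h,
    Finset.sum_pair transposition_ne_one.symm, rho_transposition, map_one, sub_eq_add_neg]
  rfl

/-- The elements on which interchanging the arguments is multiplication by `-1`. -/
def antiInvariants : AddSubgroup (IntTor.Tor₁ T T) where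
  carrier := {x | IntTor.swap T T x = -x}
  zero_mem' := by simp
  add_mem' := fun {x y} hx hy => by
    simp only [Set.mem_ofPred_eq, map_add] at hx hy ⊢
    rw [hx, hy, neg_add]
  neg_mem' := fun {x} hx => by
    simp only [Set.mem_ofPred_eq, map_neg] at hx ⊢
    rw [hx]

/-- For a finite cyclic group with generator `τ`, odd homology is `ker (τ - 1)` modulo the image of
the norm. Here `τ = -σ₁`, and the norm is `1 - σ₁`. -/
theorem exists_hom_twistedH₁ : ∃ π : antiInvariants T →+ twistedH₁ T,
    Function.Surjective π ∧ ∀ x, π x = 0 ↔ ∃ y, x.1 = y - IntTor.swap T T y := by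
  let V := Rep.of (twistedTorRepresentation T)
  let π := Rep.FiniteCyclicGroup.groupHomologyπOdd V transposition mem_zpowers_transposition 1
    odd_one
  -- `π` unfolds to an epimorphism sandwiched between inverses of isomorphisms.
  have hepi : Epi π := @epi_comp _ _ _ _ _ _
    (@IsIso.epi_of_iso _ _ _ _ _ (Iso.isIso_inv _)) _
    (@epi_comp _ _ _ _ _ _ inferInstance _ (@IsIso.epi_of_iso _ _ _ _ _ (Iso.isIso_inv _)))
  have hπ : Function.Surjective π := (ModuleCat.epi_iff_surjective π).1 hepi
  let e : antiInvariants T →+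
      LinearMap.ker (Rep.applyAsHom V transposition - 𝟙 V).hom.toLinearMap :=
    AddMonoidHom.mk' (fun x => ⟨x.1, by
      rw [LinearMap.mem_ker]
      change twistedTorRepresentation T transposition x.1 - x.1 = 0
      rw [rho_transposition, x.2, neg_neg, sub_self]⟩) fun x y => rfl
  have he : Function.Surjective e := fun x => by
    refine ⟨⟨x.1, ?_⟩, rfl⟩
    have h : twistedTorRepresentation T transposition x.1 - x.1 = 0 := LinearMap.mem_ker.1 x.2
    rw [rho_transposition, sub_eq_zero] at h
    exact neg_eq_iff_eq_neg.1 h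
  refine ⟨π.hom.toAddMonoidHom.comp e, hπ.comp he, fun x => ?_⟩
  refine (Rep.FiniteCyclicGroup.groupHomologyπOdd_eq_zero_iff V transposition
    mem_zpowers_transposition 1 odd_one (e x)).trans ?_
  constructor
  · rintro ⟨y, hy⟩
    exact ⟨y, hy.symm.trans (norm_apply T y)⟩
  · rintro ⟨y, hy⟩
    exact ⟨y, (norm_apply T y).trans hy.symm⟩

end TwistedHomology

/-! ### Assembly of the exact sequence. -/

/-- Two homomorphisms with the same kernel, the first of which is surjective, differ by an
injective homomorphism. -/
theorem AddMonoidHom.exists_injective_comp_eq {N H G : Type*} [AddCommGroup N] [AddCommGroup H]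
    [AddCommGroup G] (α : N →+ H) (β : N →+ G) (hα : Function.Surjective α)
    (h : ∀ x, α x = 0 ↔ β x = 0) : ∃ ι : H →+ G, Function.Injective ι ∧ ∀ x, ι (α x) = β x := by
  let ι : H →+ G := α.liftOfSurjective hα ⟨β, fun x hx => (h x).1 hx⟩
  have hι : ∀ x, ι (α x) = β x := fun x => α.liftOfRightInverse_comp_apply _ _ ⟨β, _⟩ x
  refine ⟨ι, (injective_iff_map_eq_zero ι).2 fun y hy => ?_, hι⟩
  obtain ⟨x, rfl⟩ := hα y
  rw [h, ← hι, hy]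

/-- The anti-invariant cycles map onto both `H₁` and the kernel of `Psi`, with the same kernel. -/
theorem exists_twistedH₁_hom (T : Type u) [AddCommGroup T] :
    ∃ ι : twistedH₁ T →+ WhiteheadGamma T, Function.Injective ι ∧
      Function.Exact ι (WhiteheadGamma.Psi T) := by
  obtain ⟨N, _, α, β, hα, hαβ, hβ⟩ := FreePresentation.exists_antiCycles_hom T
  obtain ⟨π, hπ, hπ0⟩ := TwistedHomology.exists_hom_twistedH₁ T
  let α' : N →+ TwistedHomology.antiInvariants T :=
    α.codRestrict _ fun z => (hα (α z)).1 ⟨z, rfl⟩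
  have hα' : Function.Surjective α' := fun x => by
    obtain ⟨z, hz⟩ := (hα x.1).2 x.2
    exact ⟨z, Subtype.ext hz⟩
  obtain ⟨ι, hι, hιβ⟩ := AddMonoidHom.exists_injective_comp_eq (π.comp α') β (hπ.comp hα')
    fun z => (hπ0 (α' z)).trans (hαβ z).symm
  refine ⟨ι, hι, fun c => (hβ c).trans ⟨?_, ?_⟩⟩
  · rintro ⟨z, rfl⟩
    exact ⟨_, hιβ z⟩
  · rintro ⟨x, rfl⟩
    obtain ⟨z, rfl⟩ := (hπ.comp hα') x
    exact ⟨z, (hιβ z).symm⟩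

end

theorem theoremH4 (A : Type u) [AddCommGroup A] :
    ∃ (ι : twistedH₁ (AddCommGroup.primaryComponent A 2) →+ WhiteheadGamma A)
      (π : A ⊗[ℤ] A →+ integralGroupHomology (Multiplicative A) 2),
      Function.Injective ι ∧
      Function.Exact ι (WhiteheadGamma.Psi A) ∧
      Function.Exact (WhiteheadGamma.Psi A) π ∧
      Function.Surjective π := by
  obtain ⟨ι, hι, hιΨ⟩ := exists_twistedH₁_hom (AddCommGroup.primaryComponent A 2)
  obtain ⟨θ, hθ, hθΨ, hθ'⟩ := FreePresentation.primaryComponent_comparison A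
  refine ⟨θ.comp ι, AbelianHomology.shuffleHom A, ?_, fun c => ⟨fun hc => ?_, ?_⟩,
    AbelianHomology.exact_Psi_shuffleHom A, AbelianHomology.shuffleHom_surjective A⟩
  · rw [injective_iff_map_eq_zero]
    intro x hx
    exact (map_eq_zero_iff ι hι).1 (hθ _ ((hιΨ _).2 ⟨x, rfl⟩) hx)
  · obtain ⟨c', hc', rfl⟩ := hθ' c hc
    obtain ⟨x, rfl⟩ := (hιΨ c').1 hc'
    exact ⟨x, rfl⟩
  · rintro ⟨x, rfl⟩
    exact hθΨ _ ((hιΨ _).2 ⟨x, rfl⟩)
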